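/- **Setting.** Let $\mathcal S^{d-1}$ be the unit sphere of $\mathbb R^d$, $F:\mathbb R^d\to\mathbb R$ an objective that is differentiable at the points of $\mathcal S^{d-1}$, and $D:\mathbb R^d\to\mathbb R$ with $D(v)>0$ on $\mathcal S^{d-1}$. Let $\zeta_1,\zeta_2,\dots$ be i.i.d. samples and $\Gamma(v;\zeta)$ a (jointly measurable) stochastic vector with $\mathbb E\,\Gamma(v;\zeta)=D(v)\nabla F(v)$ for all $v\in\mathcal S^{d-1}$. Stochastic scaled-gradient descent (SSGD) with step size $\eta$, started at $v_0\in\mathcal S^{d-1}$, is $$v_t=\Pi_{\mathcal S^{d-1}}\big[v_{t-1}-\eta\,\Gamma(v_{t-1};\zeta_t)\big],\qquad \Pi_{\mathcal S^{d-1}}[x]=x/\|x\|\ (\text{and } \Pi_{\mathcal S^{d-1}}[0]=0).$$ Let $v^*$ be a local minimizer of $F$ on $\mathcal S^{d-1}$, put $D=D(v^*)$, and let $\mu>0$ satisfy $u^\top\mathcal H(v^*)u\ge\mu$ for all unit vectors $u\perp v^*$, where $\mathcal H(v)=\nabla^2F(v)-\frac{v^\top\nabla F(v)}{\|v\|^2}I$.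 Assume: * (Smoothness) for some $\delta\in(0,1]$, $F$ is twice continuously differentiable around every point of $\{v:\|v\|\le1,\ \|v-v^*\|\le\delta\}$, and on this set $D(\cdot),F,\nabla F,\nabla^2F$ are Lipschitz with constants $L_D,L_F,L_K,L_Q>0$ respectively (operator norm for $\nabla^2F$). Put $\rho=D(2L_Q+\tfrac52L_F+\tfrac92L_K)+L_D(L_K+2L_F)$. * (Sub-Weibull tail) for some $\alpha\in(0,2]$ and $\mathcal V>0$, $\mathbb E\exp\big(\|\Gamma(v;\zeta)\|^\alpha/\mathcal V^\alpha\big)\le2$ for all $v\in\mathcal S^{d-1}$. * (Warm start) $\|v_0-v^*\|\le\min\{D\mu/(2^5\rho),\ \delta/2\}$. Let $G_\alpha=\log_2^{1/\alpha}(1+e^{1/\alpha})\big(1+\log_2^{1/\alpha}(1+e^{1/\alpha})\big)$. **Corollary (Finite-Sample).** For every $c\ge1$ there is a constant $C>0$, depending only on $c$ (in particular not on the dimension $d$), such that in every setting as above the following holds. Let $T\ge2$ be an integer, $\epsilon\in(0,1)$, and let the step size satisfy $\eta=\Theta\big(\frac{\log T}{D\mu T}\big)$ in the sense that $$\frac{\log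 T}{D\mu T}\le\eta\le c\,\frac{\log T}{D\mu T},$$ together with the scaling condition $$\eta\le\min\Big\{\frac{D^3\mu^3}{2^{24}G_\alpha\mathcal V^2\rho^2}\log^{-\frac{\alpha+2}{\alpha}}\epsilon^{-1},\ \ \frac{D\mu\,\delta^2}{2^{16}G_\alpha\mathcal V^2}\log^{-\frac{\alpha+2}{\alpha}}\epsilon^{-1},\ \ \frac1{D\mu}\Big\}.$$ Then there is an event $\mathscr H$ with $$\mathbb P(\mathscr H)\ge1-\Big(14+8\big(\tfrac3\alpha\big)^{\frac2\alpha}\log^{-\frac{\alpha+2}{\alpha}}\epsilon^{-1}\Big)T\epsilon$$ on which the final iterate satisfies $$\|v_T-v^*\|\le C\,\frac{G_\alpha\mathcal V}{D\mu}\,\log^{\frac{\alpha+2}{2\alpha}}\epsilon^{-1}\,\sqrt{\frac{\log T}{T}} .$$ -/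

import Mathlib

open MeasureTheory ProbabilityTheory
open scoped NNReal Gradient

noncomputable section

namespace SSGD

/-- Euclidean space `ℝ^d` with the `ℓ²` norm. -/
abbrev Vec (d : ℕ) : Type := EuclideanSpace ℝ (Fin d)

/-- The unit sphere of `ℝ^d`, the feasible set of the optimization problem. -/
def unitSphere (d : ℕ) : Set (Vec d) := Metric.sphere 0 1

/-- The region `{v : ‖v‖ ≤ 1, ‖v - v*‖ ≤ δ}` on which the smoothness assumptions are made. -/
def localRegion {d : ℕ} (vstar : Vec d) (δ : ℝ) : Set (Vec d) :=
  {v | ‖v‖ ≤ 1 ∧ ‖v - vstar‖ ≤ δ}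

/-- The Hessian `∇²F(v)` as a linear operator on `ℝ^d` (the derivative of the gradient). -/
def hessian {d : ℕ} (F : Vec d → ℝ) (v : Vec d) : Vec d →L[ℝ] Vec d :=
  fderiv ℝ (fun w => ∇ F w) v

/-- The manifold Hessian `∇²F(v) - (vᵀ∇F(v) / ‖v‖²) I`. -/
def manifoldHessian {d : ℕ} (F : Vec d → ℝ) (v : Vec d) : Vec d →L[ℝ] Vec d :=
  hessian F v - (inner ℝ v (∇ F v) / ‖v‖ ^ 2) • ContinuousLinearMap.id ℝ (Vec d)

/-- `F` is twice continuously differentiable around every point of the local region, and on that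
region `D`, `F`, `∇F`, `∇²F` are Lipschitz with the positive constants `LD`, `LF`, `LK`, `LQ`
(operator norm for the Hessian). -/
structure LocallySmooth {d : ℕ} (F D : Vec d → ℝ) (vstar : Vec d) (δ : ℝ)
    (LD LF LK LQ : ℝ≥0) : Prop where
  contDiffAt : ∀ v ∈ localRegion vstar δ, ContDiffAt ℝ 2 F v
  pos : 0 < LD ∧ 0 < LF ∧ 0 < LK ∧ 0 < LQ
  lipschitz_scale : LipschitzOnWith LD D (localRegion vstar δ)
  lipschitz_objective : LipschitzOnWith LF F (localRegion vstar δ)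
  lipschitz_gradient : LipschitzOnWith LK (fun v => ∇ F v) (localRegion vstar δ)
  lipschitz_hessian : LipschitzOnWith LQ (fun v => hessian F v) (localRegion vstar δ)

/-- For a sample `z` of law `ν`, the vector `Γ(v; z)` is, at every point of the sphere, an unbiased
estimate of the scaled gradient `D(v) ∇F(v)`, where `D(v) > 0`. -/
structure UnbiasedScaledGradient {d : ℕ} {Z : Type*} [MeasurableSpace Z] (ν : Measure Z)
    (Γ : Vec d → Z → Vec d) (F D : Vec d → ℝ) : Prop where
  measurable : Measurable (Function.uncurry Γ)
  differentiableAt : ∀ v ∈ unitSphere d, DifferentiableAt ℝ F v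
  scale_pos : ∀ v ∈ unitSphere d, 0 < D v
  mean_eq : ∀ v ∈ unitSphere d, ∫ z, Γ v z ∂ν = D v • ∇ F v

/-- The vector `α`-sub-Weibull tail: `E exp(‖Γ(v; z)‖^α / 𝒱^α) ≤ 2` for all `v` on the sphere. -/
def SubWeibull {d : ℕ} {Z : Type*} [MeasurableSpace Z] (ν : Measure Z)
    (Γ : Vec d → Z → Vec d) (α V : ℝ) : Prop :=
  ∀ v ∈ unitSphere d, ∫⁻ z, ENNReal.ofReal (Real.exp (‖Γ v z‖ ^ α / V ^ α)) ∂ν ≤ 2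

/-- Projection onto the unit sphere, `x ↦ x / ‖x‖`; at the origin, where the nearest point is not
unique, the value is `0`. -/
def sphereProj {d : ℕ} (x : Vec d) : Vec d := ‖x‖⁻¹ • x

/-- The SSGD iterates `v_t = Π[v_{t-1} - η Γ(v_{t-1}; ζ_t)]`, `t ≥ 1`, along a sample path. -/
def iterate {d : ℕ} {Z : Type*} (Γ : Vec d → Z → Vec d) (η : ℝ) (v₀ : Vec d) (ζ : ℕ → Z) :
    ℕ → Vec d
  | 0 => v₀
  | t + 1 => sphereProj (iterate Γ η v₀ ζ t - η • Γ (iterate Γ η v₀ ζ t) (ζ (t + 1)))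

/-- `G_α = log₂^{1/α}(1 + e^{1/α}) (1 + log₂^{1/α}(1 + e^{1/α}))`. -/
def G (α : ℝ) : ℝ :=
  Real.logb 2 (1 + Real.exp (1 / α)) ^ (1 / α) *
    (1 + Real.logb 2 (1 + Real.exp (1 / α)) ^ (1 / α))

/-- `ρ = D (2 L_Q + (5/2) L_F + (9/2) L_K) + L_D (L_K + 2 L_F)`. -/
def rho (D LD LF LK LQ : ℝ) : ℝ :=
  D * (2 * LQ + 5 / 2 * LF + 9 / 2 * LK) + LD * (LK + 2 * LF)

end SSGD

end

/-!
Write `r_t = ‖v_t - vstar‖`, `m = D(vstar) μ`, `L = log (1 / ε)` and `B = V L^(1/α)`. The proof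
follows the scalar process `r_t²`, which is why the constants do not depend on the dimension.

*One step.* Splitting `Γ` into a part along `v` and a tangential part `Γ_⊥`, the former only rescales
the step size, and projecting a point outside the unit ball does not increase its distance to a unit
vector. Hence `r_t² ≤ r_{t-1}² - 2 η ⟪Γ_⊥, v_{t-1} - vstar⟫ + 8 η² ‖Γ‖²` whenever `η ‖Γ‖ ≤ 1/2`
(`SSGD.norm_sphereProj_step_sq_le`).

*Drift.* At `vstar` the gradient is normal to the sphere. A Taylor expansion turns the mean of the
inner product above into the quadratic form of the manifold Hessian, up to cubic errors, so it is at
least `(3/4) m r²` while `r ≤ min (m / (16 ρ)) (9 δ / 16)` (`SSGD.LocallySmooth.drift`).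

*Concentration.* The fluctuation of the inner product is proportional to `r`. When the vectors
`Γ` are truncated at `B`, Hoeffding's lemma bounds its exponential moment by a multiple of `r²`,
which for `θ ≤ m / (8 η B²)` is absorbed by the drift. The result is
`E exp (θ (r_t² - K)) ≤ E exp (θ (1 - η m) (r_{t-1}² - K))` with a stationary level `K` of order
`η V² G L^(2/α) / m` (`SSGD.lintegral_exp_step_le`). Iterating this and applying Markov's inequality
gives `r_t² ≤ (1 - η m)^t r_0² + K + L / θ` with probability at least `1 - ε`
(`SSGD.measure_chain_ge_le`).

*Localization.* The drift and the truncation are only available on an event, so the estimate is made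
for a tamed chain that jumps to `vstar` when the truncation is active or the iterate has left the
region (`SSGD.tamedStep`). A jump decreases `r_t` and does not spoil the exponential bound. The
scaling condition on `η` keeps the tamed chain within the region, so it coincides with SSGD outside
an event of probability `3 T ε` (`SSGD.exists_event_norm_iterate_sub_sq_le`).

Finally `(1 - η m)^T ≤ 1 / T`, the drift condition at `v₀` bounds `r_0²` by `4 V² G / m²`, and
`K + L / θ` is of order `η V² G L^(1 + 2/α) / m`; all terms have the claimed order `log T / T`. If
the claimed failure probability is at least one, the empty event serves.
-/

namespace SSGD

/-! ### Sub-Weibull tails -/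

theorem one_le_logb_G {α : ℝ} (hα : 0 < α) : 1 ≤ Real.logb 2 (1 + Real.exp (1 / α)) := by
  rw [Real.le_logb_iff_rpow_le (by norm_num) (by positivity)]
  have := Real.one_le_exp (show 0 ≤ 1 / α by positivity)
  rw [Real.rpow_one]
  linarith

theorem logb_G_rpow_le_G {α : ℝ} (hα : 0 < α) :
    Real.logb 2 (1 + Real.exp (1 / α)) ^ (2 / α) ≤ G α := by
  have h1 := one_le_logb_G hα
  have h : Real.logb 2 (1 + Real.exp (1 / α)) ^ (2 / α) =
      Real.logb 2 (1 + Real.exp (1 / α)) ^ (1 / α) *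
        Real.logb 2 (1 + Real.exp (1 / α)) ^ (1 / α) := by
    rw [← Real.rpow_add (by linarith)]
    congr 1
    ring
  rw [h, G]
  gcongr
  linarith

theorem one_le_G {α : ℝ} (hα : 0 < α) : 1 ≤ G α :=
  (Real.one_le_rpow (one_le_logb_G hα) (by positivity)).trans (logb_G_rpow_le_G hα)

/-- The constant `G α` dominates the maximum `(2 / (e α)) ^ (2 / α)` of `x ^ 2 * exp (-x ^ α)`. -/
theorem sq_le_G_mul_exp {α x : ℝ} (hα : 0 < α) (hx : 0 ≤ x) :
    x ^ 2 ≤ G α * Real.exp (x ^ α) := by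
  have hp : 0 < 2 / α := by positivity
  have hy : 0 ≤ x ^ α := Real.rpow_nonneg hx _
  have h1 := one_le_logb_G hα
  have hx2 : x ^ 2 = (x ^ α) ^ (2 / α) := by
    rw [← Real.rpow_mul hx, mul_div_cancel₀ _ hα.ne', Real.rpow_two]
  have hlog : 1 / α ≤ Real.logb 2 (1 + Real.exp (1 / α)) := by
    have h2 : 1 / α ≤ Real.log (1 + Real.exp (1 / α)) := by
      rw [Real.le_log_iff_exp_le (by positivity)]
      linarith
    have hl2 : Real.log 2 ≤ 1 := by linarith [Real.log_two_lt_d9]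
    rw [Real.logb, le_div_iff₀ (Real.log_pos (by norm_num))]
    have : 0 < 1 / α := by positivity
    nlinarith
  -- `y ≤ (p / 2) exp (y / p)` for `p = 2 / α`, from `2 ≤ e` and `1 + t ≤ exp t`.
  have key : x ^ α ≤ 1 / α * Real.exp (x ^ α / (2 / α)) := by
    have h3 := Real.add_one_le_exp (x ^ α / (2 / α) - 1)
    have h4 : Real.exp (x ^ α / (2 / α)) =
        Real.exp 1 * Real.exp (x ^ α / (2 / α) - 1) := by
      rw [← Real.exp_add]
      congr 1
      ring
    have h5 : (2 : ℝ) ≤ Real.exp 1 := by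
      have := Real.add_one_le_exp 1
      linarith
    have h6 : x ^ α / (2 / α) * 2 ≤ Real.exp (x ^ α / (2 / α)) := by
      rw [h4]
      have : 0 ≤ x ^ α / (2 / α) := by positivity
      nlinarith [Real.exp_pos (x ^ α / (2 / α) - 1)]
    have h7 : x ^ α / (2 / α) * 2 = x ^ α * α := by
      field_simp
    rw [h7] at h6
    rw [one_div, inv_mul_eq_div, le_div_iff₀ hα]
    exact h6
  calc x ^ 2 = (x ^ α) ^ (2 / α) := hx2
    _ ≤ (1 / α * Real.exp (x ^ α / (2 / α))) ^ (2 / α) :=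
        Real.rpow_le_rpow hy key hp.le
    _ = (1 / α) ^ (2 / α) * Real.exp (x ^ α) := by
        rw [Real.mul_rpow (by positivity) (Real.exp_pos _).le, ← Real.exp_mul,
          div_mul_cancel₀ _ hp.ne']
    _ ≤ Real.logb 2 (1 + Real.exp (1 / α)) ^ (2 / α) * Real.exp (x ^ α) := by
        gcongr
    _ ≤ G α * Real.exp (x ^ α) := by
        gcongr
        exact logb_G_rpow_le_G hα

section Tail

variable {Z E : Type*} [MeasurableSpace Z] [NormedAddCommGroup E] {ν : Measure Z}
  {f : Z → E} {α V : ℝ}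

theorem lintegral_norm_sq_le (hα : 0 < α) (hV : 0 < V)
    (hW : ∫⁻ z, ENNReal.ofReal (Real.exp (‖f z‖ ^ α / V ^ α)) ∂ν ≤ 2) :
    ∫⁻ z, ENNReal.ofReal (‖f z‖ ^ 2) ∂ν ≤ ENNReal.ofReal (2 * V ^ 2 * G α) := by
  have hG := one_le_G hα
  have hpt : ∀ z, ‖f z‖ ^ 2 ≤ V ^ 2 * G α * Real.exp (‖f z‖ ^ α / V ^ α) := by
    intro z
    have h := sq_le_G_mul_exp hα (show 0 ≤ ‖f z‖ / V by positivity)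
    rw [Real.div_rpow (norm_nonneg _) hV.le, div_pow, div_le_iff₀ (by positivity)] at h
    linarith
  calc ∫⁻ z, ENNReal.ofReal (‖f z‖ ^ 2) ∂ν
      ≤ ∫⁻ z, ENNReal.ofReal (V ^ 2 * G α) *
          ENNReal.ofReal (Real.exp (‖f z‖ ^ α / V ^ α)) ∂ν := by
        refine lintegral_mono fun z => ?_
        rw [← ENNReal.ofReal_mul (by positivity)]
        exact ENNReal.ofReal_le_ofReal (hpt z)
    _ = ENNReal.ofReal (V ^ 2 * G α) *
          ∫⁻ z, ENNReal.ofReal (Real.exp (‖f z‖ ^ α / V ^ α)) ∂ν :=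
        lintegral_const_mul' _ _ ENNReal.ofReal_ne_top
    _ ≤ ENNReal.ofReal (V ^ 2 * G α) * 2 := by gcongr
    _ = ENNReal.ofReal (2 * V ^ 2 * G α) := by
        rw [← ENNReal.ofReal_ofNat 2, ← ENNReal.ofReal_mul (by positivity)]
        congr 1
        ring

variable [MeasurableSpace E] [BorelSpace E]

theorem integrable_norm_sq (hf : Measurable f) (hα : 0 < α) (hV : 0 < V)
    (hW : ∫⁻ z, ENNReal.ofReal (Real.exp (‖f z‖ ^ α / V ^ α)) ∂ν ≤ 2) :
    Integrable (fun z => ‖f z‖ ^ 2) ν := by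
  refine ⟨(hf.norm.pow_const 2).aestronglyMeasurable, ?_⟩
  rw [hasFiniteIntegral_iff_ofReal (Filter.Eventually.of_forall fun z => by positivity)]
  exact (lintegral_norm_sq_le hα hV hW).trans_lt ENNReal.ofReal_lt_top

theorem integral_norm_sq_le (hf : Measurable f) (hα : 0 < α) (hV : 0 < V)
    (hW : ∫⁻ z, ENNReal.ofReal (Real.exp (‖f z‖ ^ α / V ^ α)) ∂ν ≤ 2) :
    ∫ z, ‖f z‖ ^ 2 ∂ν ≤ 2 * V ^ 2 * G α := by
  have hG := one_le_G hα
  rw [integral_eq_lintegral_of_nonneg_ae (Filter.Eventually.of_forall fun z => by positivity)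
    (hf.norm.pow_const 2).aestronglyMeasurable]
  exact ENNReal.toReal_le_of_le_ofReal (by positivity) (lintegral_norm_sq_le hα hV hW)

theorem measure_norm_gt_le (hf : Measurable f) (hα : 0 < α) (hV : 0 < V)
    (hW : ∫⁻ z, ENNReal.ofReal (Real.exp (‖f z‖ ^ α / V ^ α)) ∂ν ≤ 2)
    {L : ℝ} (hL : 0 ≤ L) :
    ν {z | V * L ^ (1 / α) < ‖f z‖} ≤ ENNReal.ofReal (2 * Real.exp (-L)) := by
  have hsub : {z | V * L ^ (1 / α) < ‖f z‖} ⊆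
      {z | ENNReal.ofReal (Real.exp L) ≤ ENNReal.ofReal (Real.exp (‖f z‖ ^ α / V ^ α))} := by
    intro z hz
    refine ENNReal.ofReal_le_ofReal (Real.exp_le_exp.2 ?_)
    have h1 : L ^ (1 / α) ≤ ‖f z‖ / V := by
      rw [le_div_iff₀ hV, mul_comm]
      exact le_of_lt hz
    have h2 := Real.rpow_le_rpow (by positivity) h1 hα.le
    rwa [← Real.rpow_mul hL, one_div_mul_cancel hα.ne', Real.rpow_one,
      Real.div_rpow (norm_nonneg _) hV.le] at h2
  have hmeas : Measurable fun z => ENNReal.ofReal (Real.exp (‖f z‖ ^ α / V ^ α)) := by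
    fun_prop
  have h := (mul_meas_ge_le_lintegral₀ (μ := ν) hmeas.aemeasurable
    (ENNReal.ofReal (Real.exp L))).trans hW
  have h3 : ENNReal.ofReal (Real.exp (-L)) * ENNReal.ofReal (Real.exp L) = 1 := by
    rw [← ENNReal.ofReal_mul (Real.exp_pos _).le, ← Real.exp_add]
    simp
  calc ν {z | V * L ^ (1 / α) < ‖f z‖} ≤ _ := measure_mono hsub
    _ = ENNReal.ofReal (Real.exp (-L)) * (ENNReal.ofReal (Real.exp L) * _) := by
        rw [← mul_assoc, h3, one_mul]
    _ ≤ ENNReal.ofReal (Real.exp (-L)) * 2 := by gcongr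
    _ = ENNReal.ofReal (2 * Real.exp (-L)) := by
        rw [← ENNReal.ofReal_ofNat 2, ← ENNReal.ofReal_mul (Real.exp_pos _).le, mul_comm]

end Tail

/-! ### One projected step -/

section Projection

variable {d : ℕ}

theorem norm_sphereProj {x : Vec d} (hx : x ≠ 0) : ‖sphereProj x‖ = 1 := by
  rw [sphereProj, norm_smul, norm_inv, norm_norm, inv_mul_cancel₀ (norm_ne_zero_iff.2 hx)]

theorem sphereProj_smul {a : ℝ} (ha : 0 < a) (x : Vec d) :
    sphereProj (a • x) = sphereProj x := by
  rw [sphereProj, sphereProj, norm_smul, Real.norm_of_nonneg ha.le, smul_smul, mul_inv,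
    mul_right_comm, inv_mul_cancel₀ ha.ne', one_mul]

/-- Outside the open unit ball the projection onto the sphere is the projection onto the closed
ball, which does not increase the distance to points of the sphere. -/
theorem norm_sphereProj_sub_sq_le {y p : Vec d} (hy : 1 ≤ ‖y‖) (hp : ‖p‖ = 1) :
    ‖sphereProj y - p‖ ^ 2 ≤ ‖y - p‖ ^ 2 := by
  have hy0 : y ≠ 0 := norm_ne_zero_iff.1 (by linarith)
  have hin : inner ℝ y p ≤ ‖y‖ := by
    have := real_inner_le_norm y p
    rwa [hp, mul_one] at this
  rw [norm_sub_sq_real, norm_sub_sq_real, norm_sphereProj hy0, hp, sphereProj,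
    real_inner_smul_left]
  have hle : ‖y‖⁻¹ * inner ℝ y p ≤ 1 := by
    rw [inv_mul_le_iff₀ (by linarith)]
    linarith
  have heq : inner ℝ y p = ‖y‖ * (‖y‖⁻¹ * inner ℝ y p) := by
    rw [mul_inv_cancel_left₀ (by linarith)]
  nlinarith [mul_nonneg (sub_nonneg.2 hy) (sub_nonneg.2 hle)]

theorem norm_tangential_le {v : Vec d} (hv : ‖v‖ = 1) (g : Vec d) :
    ‖g - (inner ℝ v g : ℝ) • v‖ ≤ ‖g‖ := by
  refine (sq_le_sq₀ (norm_nonneg _) (norm_nonneg _)).1 ?_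
  rw [norm_sub_sq_real, real_inner_smul_right, real_inner_comm, norm_smul, hv,
    mul_one, Real.norm_eq_abs, sq_abs]
  nlinarith [sq_nonneg (inner ℝ v g : ℝ)]

/-- One step of the projected recursion. The radial part of `g` only rescales the step size, so up
to a second-order error the squared distance to `p` changes as under the tangential part. -/
theorem norm_sphereProj_step_sq_le {v p g : Vec d} {η : ℝ} (hv : ‖v‖ = 1) (hp : ‖p‖ = 1)
    (hη : 0 ≤ η) (hg : η * ‖g‖ ≤ 1 / 2) (hr : ‖v - p‖ ≤ 1) :
    ‖sphereProj (v - η • g) - p‖ ^ 2 ≤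
      ‖v - p‖ ^ 2 - 2 * η * inner ℝ (g - (inner ℝ v g : ℝ) • v) (v - p) +
        8 * η ^ 2 * ‖g‖ ^ 2 := by
  set s : ℝ := inner ℝ v g with hs
  set h : Vec d := g - s • v with hh
  have hs_abs : |s| ≤ ‖g‖ := by
    have := abs_real_inner_le_norm v g
    rwa [hv, one_mul] at this
  have hηs : |η * s| ≤ 1 / 2 := by
    rw [abs_mul, abs_of_nonneg hη]
    exact (mul_le_mul_of_nonneg_left hs_abs hη).trans hg
  have hvv : inner ℝ v v = (1 : ℝ) := by rw [real_inner_self_eq_norm_sq, hv, one_pow]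
  have hvh : inner ℝ v h = (0 : ℝ) := by
    rw [hh, inner_sub_right, real_inner_smul_right, hvv, ← hs]
    ring
  have hh_le : ‖h‖ ≤ ‖g‖ := norm_tangential_le hv g
  obtain ⟨ha1, ha2⟩ := abs_le.1 hηs
  set a : ℝ := 1 - η * s with ha
  have ha_half : 1 / 2 ≤ a := by linarith
  have ha_pos : 0 < a := by linarith
  set b : ℝ := η / a with hb
  have hb0 : 0 ≤ b := by positivity
  have hab : a * b = η := by rw [hb, mul_div_cancel₀ _ ha_pos.ne']
  have hb2 : b ≤ 2 * η := by nlinarith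
  have hx : v - η • g = a • (v - b • h) := by
    rw [smul_sub, smul_smul, hab, ha, hh, smul_sub, smul_smul, sub_smul, one_smul]
    abel
  have hy_norm : ‖v - b • h‖ ^ 2 = 1 + b ^ 2 * ‖h‖ ^ 2 := by
    rw [norm_sub_sq_real, real_inner_smul_right, hvh, hv, norm_smul, Real.norm_of_nonneg hb0]
    ring
  have hy1 : 1 ≤ ‖v - b • h‖ := by
    nlinarith [norm_nonneg (v - b • h), mul_nonneg (sq_nonneg b) (sq_nonneg ‖h‖)]
  rw [hx, sphereProj_smul ha_pos]
  refine (norm_sphereProj_sub_sq_le hy1 hp).trans ?_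
  have hexp : ‖v - b • h - p‖ ^ 2 =
      ‖v - p‖ ^ 2 - 2 * b * inner ℝ h (v - p) + b ^ 2 * ‖h‖ ^ 2 := by
    rw [sub_right_comm, norm_sub_sq_real, real_inner_smul_right, norm_smul,
      Real.norm_of_nonneg hb0, real_inner_comm]
    ring
  rw [hexp]
  have hin : |inner ℝ h (v - p)| ≤ ‖g‖ := by
    refine (abs_real_inner_le_norm _ _).trans ?_
    nlinarith [norm_nonneg h, norm_nonneg (v - p)]
  have hdiff : |b - η| ≤ 2 * η ^ 2 * ‖g‖ := by
    have : b - η = b * η * s := by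
      rw [ha] at hab
      linear_combination hab
    rw [this, abs_mul, abs_mul, abs_of_nonneg hb0, abs_of_nonneg hη]
    calc b * η * |s| ≤ (2 * η) * η * ‖g‖ := by gcongr
      _ = 2 * η ^ 2 * ‖g‖ := by ring
  have hcross : |(b - η) * inner ℝ h (v - p)| ≤ 2 * η ^ 2 * ‖g‖ * ‖g‖ := by
    rw [abs_mul]
    gcongr
  have hsq : b ^ 2 * ‖h‖ ^ 2 ≤ (2 * η) ^ 2 * ‖g‖ ^ 2 := by gcongr
  nlinarith [neg_le_of_abs_le hcross]

end Projection

/-! ### Drift of the tangential gradient towards the minimizer -/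

section Drift

variable {d : ℕ} {F D : Vec d → ℝ} {vstar : Vec d} {δ : ℝ} {LD LF LK LQ : ℝ≥0}

theorem norm_gradient (v : Vec d) : ‖∇ F v‖ = ‖fderiv ℝ F v‖ := by
  rw [gradient, LinearIsometryEquiv.norm_map]

theorem hasFDerivAt_gradient {v : Vec d} (h : ContDiffAt ℝ 2 F v) :
    HasFDerivAt (fun w => ∇ F w) (hessian F v) v := by
  have h1 : ContDiffAt ℝ 1 (fderiv ℝ F) v := h.fderiv_right (by norm_num)
  have h2 : DifferentiableAt ℝ (fun w => ∇ F w) v :=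
    (((InnerProductSpace.toDual ℝ (Vec d)).symm.toContinuousLinearEquiv.differentiableAt).comp v
      (h1.differentiableAt (by norm_num)))
  exact h2.hasFDerivAt

theorem localRegion_mem_nhds (hv : ‖vstar‖ = 1) (hδ : δ ≤ 1) {s : ℝ} (hs : s ∈ Set.Ioo 0 δ) :
    localRegion vstar δ ∈ nhds ((1 - s) • vstar) := by
  obtain ⟨hs0, hsδ⟩ := hs
  have h1 : (1 - s) • vstar ∈ Metric.ball (0 : Vec d) 1 := by
    rw [mem_ball_zero_iff, norm_smul, hv, Real.norm_of_nonneg (by linarith)]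
    linarith
  have h2 : (1 - s) • vstar ∈ Metric.ball vstar δ := by
    rw [mem_ball_iff_norm, sub_smul, one_smul, sub_sub_cancel_left, norm_neg, norm_smul, hv,
      Real.norm_of_nonneg hs0.le]
    linarith
  filter_upwards [Metric.isOpen_ball.mem_nhds h1, Metric.isOpen_ball.mem_nhds h2] with x hx1 hx2
  exact ⟨(mem_ball_zero_iff.1 hx1).le, (mem_ball_iff_norm.1 hx2).le⟩

theorem vstar_mem_localRegion (hv : ‖vstar‖ = 1) (hδ : 0 < δ) :
    vstar ∈ localRegion vstar δ := by
  refine ⟨hv.le, ?_⟩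
  rw [sub_self, norm_zero]
  exact hδ.le

/-- A bound along the inner normal passes to `vstar`, which lies on the boundary of the region. -/
theorem norm_le_of_norm_le_radial {E : Type*} [NormedAddCommGroup E] {g : Vec d → E} {K : ℝ≥0}
    (hg : LipschitzOnWith K g (localRegion vstar δ)) (hv : ‖vstar‖ = 1) (hδ0 : 0 < δ)
    (hδ : δ ≤ 1) {C : ℝ} (hC : ∀ s ∈ Set.Ioo 0 δ, ‖g ((1 - s) • vstar)‖ ≤ C) :
    ‖g vstar‖ ≤ C := by
  have hlim : Filter.Tendsto (fun s : ℝ => C + K * s) (nhdsWithin 0 (Set.Ioi 0))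
      (nhds (C + K * 0)) := by
    apply Filter.Tendsto.mono_left _ nhdsWithin_le_nhds
    exact (Continuous.tendsto (by fun_prop) 0)
  rw [mul_zero, add_zero] at hlim
  refine ge_of_tendsto hlim ?_
  filter_upwards [Ioo_mem_nhdsGT hδ0] with s hs
  have h1 := hg.dist_le_mul _ (vstar_mem_localRegion hv hδ0) _
    (mem_of_mem_nhds (localRegion_mem_nhds hv hδ hs))
  have h2 : dist vstar ((1 - s) • vstar) = s := by
    rw [dist_eq_norm, sub_smul, one_smul, sub_sub_cancel, norm_smul, hv,
      Real.norm_of_nonneg hs.1.le, mul_one]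
  rw [h2, dist_eq_norm] at h1
  have h3 := norm_le_norm_add_norm_sub' (g vstar) (g ((1 - s) • vstar))
  linarith [hC s hs]

theorem LocallySmooth.norm_gradient_le (h : LocallySmooth F D vstar δ LD LF LK LQ)
    (hv : ‖vstar‖ = 1) (hδ0 : 0 < δ) (hδ : δ ≤ 1) : ‖∇ F vstar‖ ≤ LF := by
  refine norm_le_of_norm_le_radial (g := fun v => ∇ F v) h.lipschitz_gradient hv hδ0 hδ
    fun s hs => ?_
  rw [norm_gradient]
  exact norm_fderiv_le_of_lipschitzOn ℝ (localRegion_mem_nhds hv hδ hs) h.lipschitz_objective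

theorem LocallySmooth.norm_hessian_le (h : LocallySmooth F D vstar δ LD LF LK LQ)
    (hv : ‖vstar‖ = 1) (hδ0 : 0 < δ) (hδ : δ ≤ 1) : ‖hessian F vstar‖ ≤ LK := by
  refine norm_le_of_norm_le_radial (g := fun v => hessian F v) h.lipschitz_hessian hv hδ0 hδ
    fun s hs => ?_
  exact norm_fderiv_le_of_lipschitzOn ℝ (localRegion_mem_nhds hv hδ hs) h.lipschitz_gradient

theorem convex_localRegion : Convex ℝ (localRegion vstar δ) := by
  have : localRegion vstar δ = Metric.closedBall 0 1 ∩ Metric.closedBall vstar δ := by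
    ext v
    simp [localRegion, dist_eq_norm]
  rw [this]
  exact (convex_closedBall _ _).inter (convex_closedBall _ _)

/-- First-order Taylor expansion of the gradient at `vstar`. -/
theorem LocallySmooth.norm_gradient_sub_sub_le (h : LocallySmooth F D vstar δ LD LF LK LQ)
    (hv : ‖vstar‖ = 1) (hδ0 : 0 < δ) {v : Vec d} (hmem : v ∈ localRegion vstar δ) :
    ‖∇ F v - ∇ F vstar - hessian F vstar (v - vstar)‖ ≤ LQ * ‖v - vstar‖ ^ 2 := by
  have hvs := vstar_mem_localRegion hv hδ0
  have key := Convex.norm_image_sub_le_of_norm_hasFDerivWithin_le'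
    (f := fun w => ∇ F w) (f' := fun w => hessian F w) (φ := hessian F vstar)
    (C := LQ * ‖v - vstar‖) (s := localRegion vstar δ ∩ Metric.closedBall vstar ‖v - vstar‖)
    (x := vstar) (y := v)
    (fun x hx => (hasFDerivAt_gradient (h.contDiffAt x hx.1)).hasFDerivWithinAt)
    (fun x hx => by
      have h1 := h.lipschitz_hessian.dist_le_mul x hx.1 vstar hvs
      rw [dist_eq_norm] at h1
      have h2 : dist x vstar ≤ ‖v - vstar‖ := hx.2
      exact h1.trans (by gcongr))
    (convex_localRegion.inter (convex_closedBall _ _))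
    ⟨hvs, Metric.mem_closedBall_self (norm_nonneg _)⟩
    ⟨hmem, by rw [Metric.mem_closedBall, dist_eq_norm]⟩
  calc _ ≤ _ := key
    _ = _ := by ring

/-- First-order optimality on the sphere: the gradient at `vstar` is normal to the sphere. -/
theorem gradient_eq_smul_of_isLocalMinOn (hF : ContDiffAt ℝ 2 F vstar) (hv : ‖vstar‖ = 1)
    (hmin : IsLocalMinOn F (unitSphere d) vstar) :
    ∇ F vstar = (inner ℝ vstar (∇ F vstar) : ℝ) • vstar := by
  have hset : {x : Vec d | ‖x‖ ^ 2 = ‖vstar‖ ^ 2} = unitSphere d := by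
    ext x
    simp [unitSphere, hv, pow_eq_one_iff_of_nonneg]
  have hext : IsLocalExtrOn F {x : Vec d | ‖x‖ ^ 2 = ‖vstar‖ ^ 2} vstar := by
    rw [hset]
    exact Or.inl hmin
  obtain ⟨a, b, hne, hab⟩ := IsLocalExtrOn.exists_multipliers_of_hasStrictFDerivAt_1d hext
    (hasStrictFDerivAt_norm_sq vstar) (hF.hasStrictFDerivAt (by norm_num))
  have happ : ∀ u : Vec d, a * (2 * inner ℝ vstar u) + b * inner ℝ (∇ F vstar) u = 0 := by
    intro u
    have h1 := congrArg (fun φ : StrongDual ℝ (Vec d) => φ u) hab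
    have h2 : inner ℝ (∇ F vstar) u = fderiv ℝ F vstar u := by
      rw [gradient, InnerProductSpace.toDual_symm_apply]
    rw [h2]
    simpa using h1
  have hvv : inner ℝ vstar vstar = (1 : ℝ) := by rw [real_inner_self_eq_norm_sq, hv, one_pow]
  have hb : b ≠ 0 := by
    rintro rfl
    have := happ vstar
    rw [hvv] at this
    apply hne
    ext <;> simp
    linarith
  set s : ℝ := inner ℝ vstar (∇ F vstar) with hs
  have hperp : inner ℝ vstar (∇ F vstar - s • vstar) = (0 : ℝ) := by
    rw [inner_sub_right, real_inner_smul_right, hvv, ← hs]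
    ring
  have h1 := happ (∇ F vstar - s • vstar)
  rw [hperp] at h1
  have h2 : inner ℝ (∇ F vstar) (∇ F vstar - s • vstar) = (0 : ℝ) := by
    simpa [hb] using h1
  have h3 : inner ℝ (∇ F vstar - s • vstar) (∇ F vstar - s • vstar) = (0 : ℝ) := by
    rw [inner_sub_left, h2, real_inner_smul_left, hperp]
    ring
  exact sub_eq_zero.1 (inner_self_eq_zero.1 h3)

/-- For unit vectors the chord `v - vstar` has a normal component of second order, so
`v - vstar + (‖v - vstar‖² / 2) vstar` is tangent to the sphere at `vstar`. -/
theorem inner_sub_self_of_norm_eq_one {v : Vec d} (hv : ‖v‖ = 1) (hvs : ‖vstar‖ = 1) :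
    inner ℝ vstar (v - vstar) = -(‖v - vstar‖ ^ 2 / 2) ∧
      inner ℝ v (v - vstar) = ‖v - vstar‖ ^ 2 / 2 := by
  have h := norm_sub_sq_real v vstar
  rw [hv, hvs] at h
  rw [inner_sub_right, inner_sub_right, real_inner_self_eq_norm_sq, real_inner_self_eq_norm_sq,
    hv, hvs, real_inner_comm]
  constructor <;> linarith

theorem mul_norm_sq_le_inner_manifoldHessian {μ : ℝ}
    (hμ : ∀ u : Vec d, inner ℝ u vstar = 0 → ‖u‖ = 1 →
      μ ≤ inner ℝ u (manifoldHessian F vstar u))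
    {u : Vec d} (hu : inner ℝ u vstar = 0) :
    μ * ‖u‖ ^ 2 ≤ inner ℝ u (manifoldHessian F vstar u) := by
  rcases eq_or_ne u 0 with rfl | h0
  · simp
  have hn : 0 < ‖u‖ := norm_pos_iff.2 h0
  have h := hμ (‖u‖⁻¹ • u) (by rw [real_inner_smul_left, hu, mul_zero])
    (by rw [norm_smul, norm_inv, norm_norm, inv_mul_cancel₀ hn.ne'])
  rw [map_smul, real_inner_smul_left, real_inner_smul_right, ← mul_assoc, ← mul_inv,
    inv_mul_eq_div, le_div_iff₀ (by positivity)] at h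
  rwa [sq]

theorem inner_manifoldHessian (hvs : ‖vstar‖ = 1) (u : Vec d) :
    inner ℝ u (manifoldHessian F vstar u) =
      inner ℝ u (hessian F vstar u) - inner ℝ vstar (∇ F vstar) * ‖u‖ ^ 2 := by
  rw [manifoldHessian, hvs]
  simp [inner_sub_right, real_inner_smul_right]

/-- The tangential gradient points away from `vstar`: its inner product with `v - vstar` is
quadratic in the distance up to a cubic error. The normal component of the gradient at `vstar`
enters exactly as in the manifold Hessian. -/
theorem LocallySmooth.le_inner_tangential_gradient (h : LocallySmooth F D vstar δ LD LF LK LQ)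
    (hvs : ‖vstar‖ = 1) (hmin : IsLocalMinOn F (unitSphere d) vstar) (hδ0 : 0 < δ) (hδ : δ ≤ 1)
    {μ : ℝ} (hμ : ∀ u : Vec d, inner ℝ u vstar = 0 → ‖u‖ = 1 →
      μ ≤ inner ℝ u (manifoldHessian F vstar u))
    {v : Vec d} (hv : ‖v‖ = 1) (hr : ‖v - vstar‖ ≤ δ) :
    μ * (‖v - vstar‖ ^ 2 - ‖v - vstar‖ ^ 4 / 4) - (LQ + 2 * LK) * ‖v - vstar‖ ^ 3 ≤
      inner ℝ (∇ F v - (inner ℝ v (∇ F v) : ℝ) • v) (v - vstar) := by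
  have hmem : v ∈ localRegion vstar δ := ⟨hv.le, hr⟩
  have hsmem := vstar_mem_localRegion hvs hδ0
  obtain ⟨hin1, hin2⟩ := inner_sub_self_of_norm_eq_one hv hvs
  have hgrad := gradient_eq_smul_of_isLocalMinOn (h.contDiffAt _ hsmem) hvs hmin
  have htay := h.norm_gradient_sub_sub_le hvs hδ0 hmem
  have hlip := h.lipschitz_gradient.dist_le_mul v hmem vstar hsmem
  rw [dist_eq_norm, dist_eq_norm] at hlip
  have hH := h.norm_hessian_le hvs hδ0 hδ
  set H := hessian F vstar with hHdef
  set w : Vec d := v - vstar with hw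
  set r : ℝ := ‖w‖ with hrdef
  set lam : ℝ := inner ℝ vstar (∇ F vstar) with hlam
  have hr0 : 0 ≤ r := norm_nonneg _
  have hr1 : r ≤ 1 := hr.trans hδ
  set p : Vec d := w + (r ^ 2 / 2) • vstar with hp
  have hvv : inner ℝ vstar vstar = (1 : ℝ) := by rw [real_inner_self_eq_norm_sq, hvs, one_pow]
  have hpv : inner ℝ p vstar = (0 : ℝ) := by
    rw [hp, inner_add_left, real_inner_smul_left, hvv, real_inner_comm, hin1]
    ring
  have hpn : ‖p‖ ^ 2 = r ^ 2 - r ^ 4 / 4 := by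
    rw [hp, norm_add_sq_real, real_inner_smul_right, real_inner_comm, hin1, norm_smul, hvs,
      Real.norm_of_nonneg (by positivity)]
    ring
  have hpr : ‖p‖ ≤ r := by
    refine (sq_le_sq₀ (norm_nonneg _) hr0).1 ?_
    rw [hpn]
    nlinarith [pow_nonneg hr0 4]
  have hquad := mul_norm_sq_le_inner_manifoldHessian hμ hpv
  rw [inner_manifoldHessian hvs, hpn] at hquad
  have hbd : ∀ x y : Vec d, |inner ℝ x (H y)| ≤ LK * (‖x‖ * ‖y‖) := by
    intro x y
    calc |inner ℝ x (H y)| ≤ ‖x‖ * ‖H y‖ := abs_real_inner_le_norm _ _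
      _ ≤ ‖x‖ * (LK * ‖y‖) := by
          gcongr
          exact H.le_of_opNorm_le hH y
      _ = _ := by ring
  have hLK : (0 : ℝ) ≤ LK := LK.coe_nonneg
  have hb1 : |inner ℝ p (H vstar)| ≤ LK * r := by
    refine (hbd _ _).trans ?_
    rw [hvs, mul_one]
    gcongr
  have hb2 : |inner ℝ vstar (H p)| ≤ LK * r := by
    refine (hbd _ _).trans ?_
    rw [hvs, one_mul]
    gcongr
  have hb3 : |inner ℝ vstar (H vstar)| ≤ LK := by
    refine (hbd _ _).trans ?_
    rw [hvs, mul_one, mul_one]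
  have hwp : w = p - (r ^ 2 / 2) • vstar := by rw [hp, add_sub_cancel_right]
  have hHw : inner ℝ w (H w) = inner ℝ p (H p) -
      r ^ 2 / 2 * (inner ℝ p (H vstar) + inner ℝ vstar (H p)) +
        (r ^ 2 / 2) ^ 2 * inner ℝ vstar (H vstar) := by
    rw [hwp, map_sub, map_smul]
    simp only [inner_sub_left, inner_sub_right, real_inner_smul_left, real_inner_smul_right]
    ring
  set e : Vec d := ∇ F v - ∇ F vstar - H w with he
  have hE1 : |inner ℝ w e| ≤ LQ * r ^ 3 := by
    calc |inner ℝ w e| ≤ r * ‖e‖ := abs_real_inner_le_norm _ _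
      _ ≤ r * (LQ * r ^ 2) := by gcongr
      _ = _ := by ring
  have hE2 : |inner ℝ v (∇ F v - ∇ F vstar)| ≤ LK * r := by
    refine (abs_real_inner_le_norm _ _).trans ?_
    rw [hv, one_mul]
    exact hlip
  have h1 : inner ℝ w (∇ F v) = -(lam * (r ^ 2 / 2)) + inner ℝ w (H w) + inner ℝ w e := by
    have : ∇ F v = ∇ F vstar + H w + e := by rw [he]; abel
    rw [this, inner_add_right, inner_add_right, hgrad, real_inner_smul_right, real_inner_comm,
      hin1]
    ring
  have h2 : inner ℝ v (∇ F v) = inner ℝ v (∇ F v - ∇ F vstar) + lam * (1 - r ^ 2 / 2) := by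
    have hvvs : inner ℝ v vstar = (1 : ℝ) - r ^ 2 / 2 := by
      have : v = w + vstar := by rw [hw, sub_add_cancel]
      rw [this, inner_add_left, hvv, real_inner_comm, hin1]
      ring
    rw [inner_sub_right]
    conv_rhs => rw [hgrad, real_inner_smul_right, hvvs]
    ring
  have hq : inner ℝ (∇ F v - (inner ℝ v (∇ F v) : ℝ) • v) w =
      inner ℝ w (H w) - lam * (r ^ 2 - r ^ 4 / 4) + inner ℝ w e -
        r ^ 2 / 2 * inner ℝ v (∇ F v - ∇ F vstar) := by
    rw [inner_sub_left, real_inner_smul_left, hin2, real_inner_comm, h1, h2]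
    ring
  rw [hq, hHw]
  have hr2 : 0 ≤ r ^ 2 / 2 := by positivity
  have hc1 := mul_le_mul_of_nonneg_left (le_of_abs_le hb1) hr2
  have hc2 := mul_le_mul_of_nonneg_left (le_of_abs_le hb2) hr2
  have hc3 := mul_le_mul_of_nonneg_left (neg_le_of_abs_le hb3) (sq_nonneg (r ^ 2 / 2))
  have hc4 := mul_le_mul_of_nonneg_left (le_of_abs_le hE2) hr2
  have hc5 := neg_le_of_abs_le hE1
  have hc6 : r ^ 4 * LK ≤ r ^ 3 * LK := by
    gcongr ?_ * _
    exact pow_le_pow_of_le_one hr0 hr1 (by norm_num)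
  have hc7 : 0 ≤ r ^ 3 * LK := by positivity
  nlinarith

/-- Near `vstar` the mean of the stochastic vector has a drift towards `vstar`. -/
theorem LocallySmooth.drift (h : LocallySmooth F D vstar δ LD LF LK LQ)
    (hvs : ‖vstar‖ = 1) (hmin : IsLocalMinOn F (unitSphere d) vstar) (hδ0 : 0 < δ) (hδ : δ ≤ 1)
    {μ : ℝ} (hμ0 : 0 < μ) (hμ : ∀ u : Vec d, inner ℝ u vstar = 0 → ‖u‖ = 1 →
      μ ≤ inner ℝ u (manifoldHessian F vstar u))
    {v : Vec d} (hv : ‖v‖ = 1) (hr : ‖v - vstar‖ ≤ δ) (hr' : ‖v - vstar‖ ≤ 9 / 16)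
    (hD : 0 < D vstar)
    (hρ : rho (D vstar) LD LF LK LQ * ‖v - vstar‖ ≤ D vstar * μ / 16) :
    3 / 4 * (D vstar * μ) * ‖v - vstar‖ ^ 2 ≤
      D v * inner ℝ (∇ F v - (inner ℝ v (∇ F v) : ℝ) • v) (v - vstar) := by
  have hq := h.le_inner_tangential_gradient hvs hmin hδ0 hδ hμ hv hr
  have hmem : v ∈ localRegion vstar δ := ⟨hv.le, hr⟩
  have hsmem := vstar_mem_localRegion hvs hδ0
  have hDl := h.lipschitz_scale.dist_le_mul v hmem vstar hsmem
  rw [dist_eq_norm, dist_eq_norm, Real.norm_eq_abs] at hDl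
  have hDv := neg_le_of_abs_le hDl
  have hH := h.norm_hessian_le hvs hδ0 hδ
  have hgr := h.norm_gradient_le hvs hδ0 hδ
  obtain ⟨hin1, hin2⟩ := inner_sub_self_of_norm_eq_one hv hvs
  have hLD : (0 : ℝ) ≤ LD := LD.coe_nonneg
  have hLK : (0 : ℝ) ≤ LK := LK.coe_nonneg
  have hLF : (0 : ℝ) ≤ LF := LF.coe_nonneg
  have hLQ : (0 : ℝ) ≤ LQ := LQ.coe_nonneg
  set q : ℝ := inner ℝ (∇ F v - (inner ℝ v (∇ F v) : ℝ) • v) (v - vstar) with hqdef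
  rcases eq_or_ne v vstar with heq | hne
  · rw [hqdef, heq]
    simp
  have hr0 : 0 < ‖v - vstar‖ := norm_pos_iff.2 (sub_ne_zero.2 hne)
  -- A nonzero tangent vector exists, so `μ` is at most the norm of the manifold Hessian.
  have hμle : μ ≤ LK + LF := by
    set u : Vec d := v - vstar + (‖v - vstar‖ ^ 2 / 2) • vstar with hu
    have hvv : inner ℝ vstar vstar = (1 : ℝ) := by
      rw [real_inner_self_eq_norm_sq, hvs, one_pow]
    have hpv : inner ℝ u vstar = (0 : ℝ) := by
      rw [hu, inner_add_left, real_inner_smul_left, hvv, real_inner_comm, hin1]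
      ring
    have hpn : ‖u‖ ^ 2 = ‖v - vstar‖ ^ 2 - ‖v - vstar‖ ^ 4 / 4 := by
      rw [hu, norm_add_sq_real, real_inner_smul_right, real_inner_comm, hin1, norm_smul, hvs,
        Real.norm_of_nonneg (by positivity)]
      ring
    have hupos : 0 < ‖u‖ ^ 2 := by
      rw [hpn]
      have : ‖v - vstar‖ ^ 2 * ‖v - vstar‖ ^ 2 ≤ ‖v - vstar‖ ^ 2 * 1 := by
        gcongr
        nlinarith
      nlinarith [sq_pos_of_pos hr0]
    have hquad := mul_norm_sq_le_inner_manifoldHessian hμ hpv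
    rw [inner_manifoldHessian hvs] at hquad
    have h1 : inner ℝ u (hessian F vstar u) ≤ LK * ‖u‖ ^ 2 := by
      calc inner ℝ u (hessian F vstar u) ≤ ‖u‖ * ‖hessian F vstar u‖ := real_inner_le_norm _ _
        _ ≤ ‖u‖ * (LK * ‖u‖) := by
            gcongr
            exact (hessian F vstar).le_of_opNorm_le hH u
        _ = _ := by ring
    have h2 : -(LF : ℝ) ≤ inner ℝ vstar (∇ F vstar) := by
      have := abs_real_inner_le_norm vstar (∇ F vstar)
      rw [hvs, one_mul] at this
      exact neg_le_of_abs_le (this.trans hgr)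
    have h3 : μ * ‖u‖ ^ 2 ≤ (LK + LF) * ‖u‖ ^ 2 := by nlinarith
    exact le_of_mul_le_mul_right h3 hupos
  set r : ℝ := ‖v - vstar‖ with hrdef
  rw [rho] at hρ
  have hDle : LD * r ≤ D vstar / 16 := by
    have h1 : (LD * r) * μ ≤ D vstar / 16 * μ := by
      have h2 : (LD * r) * μ ≤ (LD * r) * (LK + LF) := by gcongr
      have h3 : 0 ≤ D vstar * (2 * LQ + 5 / 2 * LF + 9 / 2 * LK) * r := by positivity
      have h4 : 0 ≤ LD * LF * r := by positivity
      linarith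
    exact le_of_mul_le_mul_right h1 hμ0
  have hcub : (LQ + 2 * LK) * r ≤ μ / 32 := by
    have h1 : D vstar * ((LQ + 2 * LK) * r) ≤ D vstar * (μ / 32) := by
      have h3 : 0 ≤ D vstar * (5 / 2 * LF + 1 / 2 * LK) * r := by positivity
      have h4 : 0 ≤ LD * (LK + 2 * LF) * r := by positivity
      linarith
    exact le_of_mul_le_mul_left h1 hD
  have hr2 : r ^ 2 ≤ 81 / 256 := by nlinarith
  have hq2 : 85 / 100 * μ * r ^ 2 ≤ q := by
    have h1 : (LQ + 2 * LK) * r * r ^ 2 ≤ μ / 32 * r ^ 2 := by gcongr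
    have h2 : μ * r ^ 2 * r ^ 2 ≤ μ * r ^ 2 * (81 / 256) := by gcongr
    have h3 : 0 ≤ μ * r ^ 2 := by positivity
    linarith
  have hDv2 : 15 / 16 * D vstar ≤ D v := by linarith
  have h0 : 0 ≤ D vstar * (μ * r ^ 2) := by positivity
  calc 3 / 4 * (D vstar * μ) * r ^ 2 ≤ (15 / 16 * D vstar) * (85 / 100 * μ * r ^ 2) := by
        linarith
    _ ≤ D v * q := by
        have : 0 ≤ D v := by linarith
        gcongr

end Drift

/-! ### Exponential moments along Markov chains driven by i.i.d. samples -/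

section Chain

variable {X Z Ω : Type*}

/-- The trajectory of the random recursion `x_{t+1} = Φ(x_t, ζ_{t+1})` started at `x₀`. As in
`SSGD.iterate`, the sample with index `0` is not used. -/
def chain (Φ : X → Z → X) (x₀ : X) (ζ : ℕ → Z) : ℕ → X
  | 0 => x₀
  | t + 1 => Φ (chain Φ x₀ ζ t) (ζ (t + 1))

variable [MeasurableSpace X] [MeasurableSpace Z] {ν : Measure Z} {ζ : ℕ → Ω → Z}
  {Φ : X → Z → X} {x₀ : X}

theorem measurable_chain_iSup_comap (hΦ : Measurable (Function.uncurry Φ)) (t : ℕ) :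
    Measurable[⨆ i ∈ Set.Iic t, MeasurableSpace.comap (ζ i) inferInstance]
      (fun ω => chain Φ x₀ (fun s => ζ s ω) t) := by
  induction t with
  | zero => exact @measurable_const _ _ _ _ _
  | succ t ih =>
    have h1 : Measurable[⨆ i ∈ Set.Iic (t + 1), MeasurableSpace.comap (ζ i) inferInstance]
        (fun ω => chain Φ x₀ (fun s => ζ s ω) t) :=
      ih.mono (biSup_mono fun i (hi : i ≤ t) => Nat.le_succ_of_le hi) le_rfl
    have h2 : Measurable[⨆ i ∈ Set.Iic (t + 1), MeasurableSpace.comap (ζ i) inferInstance]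
        (ζ (t + 1)) :=
      (comap_measurable (ζ (t + 1))).mono
        (le_biSup (fun i => MeasurableSpace.comap (ζ i) inferInstance)
          (Set.mem_Iic.2 le_rfl)) le_rfl
    have h3 := h1.prodMk h2
    exact (hΦ.comp h3 :)

variable [MeasurableSpace Ω] {P : Measure Ω}

theorem measurable_chain (hΦ : Measurable (Function.uncurry Φ)) (hζ : ∀ t, Measurable (ζ t))
    (t : ℕ) : Measurable (fun ω => chain Φ x₀ (fun s => ζ s ω) t) :=
  (measurable_chain_iSup_comap hΦ t).mono (iSup₂_le fun i _ => (hζ i).comap_le) le_rfl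

theorem indepFun_chain [IsProbabilityMeasure P] (hΦ : Measurable (Function.uncurry Φ))
    (hζ : ∀ t, Measurable (ζ t)) (hind : iIndepFun ζ P) (t : ℕ) :
    IndepFun (fun ω => chain Φ x₀ (fun s => ζ s ω) t) (ζ (t + 1)) P := by
  have h := indep_iSup_of_disjoint (fun i => (hζ i).comap_le)
    ((iIndepFun_iff_iIndep _ _ _).1 hind) (S := Set.Iic t) (T := {t + 1}) (by simp)
  rw [IndepFun_iff_Indep]
  refine indep_of_indep_of_le_left (indep_of_indep_of_le_right h ?_) ?_
  · simp
  · exact (measurable_chain_iSup_comap hΦ t).comap_le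

/-- The sample used in step `t + 1` may be integrated out with the state at time `t` frozen. -/
theorem lintegral_chain [IsProbabilityMeasure P] (hΦ : Measurable (Function.uncurry Φ))
    (hζ : ∀ t, Measurable (ζ t)) (hind : iIndepFun ζ P) (hlaw : ∀ t, P.map (ζ t) = ν)
    {h : X → Z → ENNReal} (hh : Measurable (Function.uncurry h)) (t : ℕ) :
    ∫⁻ ω, h (chain Φ x₀ (fun s => ζ s ω) t) (ζ (t + 1) ω) ∂P =
      ∫⁻ ω, ∫⁻ z, h (chain Φ x₀ (fun s => ζ s ω) t) z ∂ν ∂P := by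
  have hm := measurable_chain (x₀ := x₀) hΦ hζ t
  have : IsProbabilityMeasure ν := hlaw 0 ▸ Measure.isProbabilityMeasure_map (hζ 0).aemeasurable
  have hprod := (indepFun_iff_map_prod_eq_prod_map_map hm.aemeasurable
    (hζ (t + 1)).aemeasurable).1 (indepFun_chain (x₀ := x₀) hΦ hζ hind t)
  rw [hlaw] at hprod
  calc ∫⁻ ω, h (chain Φ x₀ (fun s => ζ s ω) t) (ζ (t + 1) ω) ∂P
      = ∫⁻ y, Function.uncurry h y
          ∂(P.map fun ω => (chain Φ x₀ (fun s => ζ s ω) t, ζ (t + 1) ω)) :=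
        (lintegral_map hh (hm.prodMk (hζ (t + 1)))).symm
    _ = ∫⁻ x, ∫⁻ z, h x z ∂ν ∂(P.map fun ω => chain Φ x₀ (fun s => ζ s ω) t) := by
        rw [hprod, lintegral_prod _ hh.aemeasurable]
        rfl
    _ = _ := lintegral_map (Measurable.lintegral_prod_right' hh) hm

/-- If the exponential moments of `A - K` contract by the factor `β` in the exponent along each
transition, they do so geometrically along the chain. -/
theorem lintegral_exp_chain_le [IsProbabilityMeasure P] (hΦ : Measurable (Function.uncurry Φ))
    (hζ : ∀ t, Measurable (ζ t)) (hind : iIndepFun ζ P) (hlaw : ∀ t, P.map (ζ t) = ν)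
    {A : X → ℝ} (hA : Measurable A) {β K θ : ℝ} (hβ0 : 0 ≤ β) (hβ1 : β ≤ 1)
    (hstep : ∀ x, ∀ s ∈ Set.Icc 0 θ,
      ∫⁻ z, ENNReal.ofReal (Real.exp (s * (A (Φ x z) - K))) ∂ν ≤
        ENNReal.ofReal (Real.exp (s * β * (A x - K)))) (t : ℕ) :
    ∀ s ∈ Set.Icc 0 θ,
      ∫⁻ ω, ENNReal.ofReal (Real.exp (s * (A (chain Φ x₀ (fun i => ζ i ω) t) - K))) ∂P ≤
        ENNReal.ofReal (Real.exp (s * β ^ t * (A x₀ - K))) := by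
  induction t with
  | zero =>
    intro s _
    simp [chain]
  | succ t ih =>
    intro s hs
    have hmeas : Measurable (Function.uncurry fun x z =>
        ENNReal.ofReal (Real.exp (s * (A (Φ x z) - K)))) := by
      have : Measurable fun y : X × Z => A (Φ y.1 y.2) := hA.comp hΦ
      exact ((this.sub_const K).const_mul s).exp.ennreal_ofReal
    have hsβ : s * β ∈ Set.Icc 0 θ :=
      ⟨mul_nonneg hs.1 hβ0, (mul_le_of_le_one_right hs.1 hβ1).trans hs.2⟩
    calc ∫⁻ ω, ENNReal.ofReal (Real.exp (s * (A (chain Φ x₀ (fun i => ζ i ω) (t + 1)) - K))) ∂P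
        = ∫⁻ ω, ∫⁻ z, ENNReal.ofReal
            (Real.exp (s * (A (Φ (chain Φ x₀ (fun i => ζ i ω) t) z) - K))) ∂ν ∂P :=
          lintegral_chain hΦ hζ hind hlaw hmeas t
      _ ≤ ∫⁻ ω, ENNReal.ofReal
            (Real.exp (s * β * (A (chain Φ x₀ (fun i => ζ i ω) t) - K))) ∂P :=
          lintegral_mono fun ω => hstep _ s hs
      _ ≤ ENNReal.ofReal (Real.exp (s * β * β ^ t * (A x₀ - K))) := ih _ hsβ
      _ = _ := by rw [pow_succ']; ring_nf

theorem measure_chain_ge_le [IsProbabilityMeasure P] (hΦ : Measurable (Function.uncurry Φ))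
    (hζ : ∀ t, Measurable (ζ t)) (hind : iIndepFun ζ P) (hlaw : ∀ t, P.map (ζ t) = ν)
    {A : X → ℝ} (hA : Measurable A) {β K θ : ℝ} (hβ0 : 0 ≤ β) (hβ1 : β ≤ 1) (hK : 0 ≤ K)
    (hθ : 0 < θ)
    (hstep : ∀ x, ∀ s ∈ Set.Icc 0 θ,
      ∫⁻ z, ENNReal.ofReal (Real.exp (s * (A (Φ x z) - K))) ∂ν ≤
        ENNReal.ofReal (Real.exp (s * β * (A x - K)))) (t : ℕ) (L : ℝ) :
    P {ω | β ^ t * A x₀ + K + L / θ ≤ A (chain Φ x₀ (fun i => ζ i ω) t)} ≤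
      ENNReal.ofReal (Real.exp (-L)) := by
  have hm := measurable_chain (x₀ := x₀) hΦ hζ t
  have hle := lintegral_exp_chain_le (x₀ := x₀) hΦ hζ hind hlaw hA hβ0 hβ1 hstep t θ
    ⟨hθ.le, le_rfl⟩
  set M : ℝ := θ * β ^ t * A x₀ with hM
  have hle2 : ∫⁻ ω, ENNReal.ofReal
      (Real.exp (θ * (A (chain Φ x₀ (fun i => ζ i ω) t) - K))) ∂P ≤
        ENNReal.ofReal (Real.exp M) := by
    refine hle.trans (ENNReal.ofReal_le_ofReal (Real.exp_le_exp.2 ?_))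
    have : 0 ≤ θ * β ^ t * K := by positivity
    rw [hM]
    linarith
  have hsub : {ω | β ^ t * A x₀ + K + L / θ ≤ A (chain Φ x₀ (fun i => ζ i ω) t)} ⊆
      {ω | ENNReal.ofReal (Real.exp (M + L)) ≤ ENNReal.ofReal
        (Real.exp (θ * (A (chain Φ x₀ (fun i => ζ i ω) t) - K)))} := by
    intro ω hω
    refine ENNReal.ofReal_le_ofReal (Real.exp_le_exp.2 ?_)
    have hω' : β ^ t * A x₀ + K + L / θ ≤ A (chain Φ x₀ (fun i => ζ i ω) t) := hω
    have h1 : β ^ t * A x₀ + L / θ ≤ A (chain Φ x₀ (fun i => ζ i ω) t) - K := by linarith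
    calc M + L = θ * (β ^ t * A x₀ + L / θ) := by
          rw [hM, mul_add, mul_div_cancel₀ _ hθ.ne']
          ring
      _ ≤ _ := mul_le_mul_of_nonneg_left h1 hθ.le
  have hmeas : Measurable fun ω => ENNReal.ofReal
      (Real.exp (θ * (A (chain Φ x₀ (fun i => ζ i ω) t) - K))) :=
    (((hA.comp hm).sub_const K).const_mul θ).exp.ennreal_ofReal
  have hmk := (mul_meas_ge_le_lintegral₀ (μ := P) hmeas.aemeasurable
    (ENNReal.ofReal (Real.exp (M + L)))).trans hle2
  have h3 : ENNReal.ofReal (Real.exp (-(M + L))) * ENNReal.ofReal (Real.exp (M + L)) = 1 := by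
    rw [← ENNReal.ofReal_mul (Real.exp_pos _).le, ← Real.exp_add]
    simp
  calc _ ≤ _ := measure_mono hsub
    _ = ENNReal.ofReal (Real.exp (-(M + L))) * (ENNReal.ofReal (Real.exp (M + L)) * _) := by
        rw [← mul_assoc, h3, one_mul]
    _ ≤ ENNReal.ofReal (Real.exp (-(M + L))) * ENNReal.ofReal (Real.exp M) := by gcongr
    _ = ENNReal.ofReal (Real.exp (-L)) := by
        rw [← ENNReal.ofReal_mul (Real.exp_pos _).le, ← Real.exp_add]
        ring_nf

end Chain

/-- Hoeffding's lemma with an upper bound on the mean. -/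
theorem lintegral_exp_mul_le {Z : Type*} [MeasurableSpace Z] {ν : Measure Z}
    [IsProbabilityMeasure ν] {Y : Z → ℝ} (hY : Measurable Y) {b m s : ℝ} (hb : ∀ z, |Y z| ≤ b)
    (hm : ∫ z, Y z ∂ν ≤ m) (hs : 0 ≤ s) :
    ∫⁻ z, ENNReal.ofReal (Real.exp (s * Y z)) ∂ν ≤
      ENNReal.ofReal (Real.exp (s * m + s ^ 2 * b ^ 2 / 2)) := by
  have hsub := hasSubgaussianMGF_of_mem_Icc (μ := ν) (a := -b) (b := b) hY.aemeasurable
    (Filter.Eventually.of_forall fun z => abs_le.1 (hb z))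
  have hmgf := hsub.mgf_le s
  have hint := hsub.integrable_exp_mul s
  set c : ℝ := ∫ z, Y z ∂ν with hc
  have hcoef : (((‖b - -b‖₊ / 2) ^ 2 : ℝ≥0) : ℝ) = b ^ 2 := by
    rw [NNReal.coe_pow, NNReal.coe_div, coe_nnnorm, Real.norm_eq_abs, div_pow, sq_abs]
    push_cast
    ring
  rw [hcoef, mgf] at hmgf
  have hfac : ∀ z, Real.exp (s * Y z) = Real.exp (s * c) * Real.exp (s * (Y z - c)) := by
    intro z
    rw [← Real.exp_add]
    ring_nf
  simp_rw [hfac]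
  rw [← ofReal_integral_eq_lintegral_ofReal (hint.const_mul _)
    (Filter.Eventually.of_forall fun z => by positivity), integral_const_mul]
  refine ENNReal.ofReal_le_ofReal ?_
  calc _ ≤ Real.exp (s * c) * Real.exp (b ^ 2 * s ^ 2 / 2) := by gcongr
    _ ≤ Real.exp (s * m) * Real.exp (b ^ 2 * s ^ 2 / 2) := by gcongr
    _ = _ := by
        rw [← Real.exp_add]
        ring_nf

/-! ### The tamed iteration -/

section Tamed

variable {d : ℕ} {Z : Type*}

open Classical in
/-- The transition of SSGD, modified to jump to `vstar` whenever the current point is not a unit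
vector within distance `R` of `vstar` or the stochastic vector has norm above `B`. The iteration
of this transition agrees with SSGD as long as no such jump occurs. -/
noncomputable def tamedStep (Γ : Vec d → Z → Vec d) (η R B : ℝ) (vstar u : Vec d) (z : Z) : Vec d :=
  if (‖u‖ = 1 ∧ ‖u - vstar‖ ≤ R) ∧ ‖Γ u z‖ ≤ B then sphereProj (u - η • Γ u z) else vstar

variable [MeasurableSpace Z]

theorem measurable_sphereProj : Measurable (sphereProj : Vec d → Vec d) := by
  unfold sphereProj
  fun_prop

theorem measurable_tamedStep {Γ : Vec d → Z → Vec d} (hΓ : Measurable (Function.uncurry Γ))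
    (η R B : ℝ) (vstar : Vec d) :
    Measurable (Function.uncurry (tamedStep Γ η R B vstar)) := by
  have hΓ' : Measurable fun y : Vec d × Z => Γ y.1 y.2 := hΓ
  unfold tamedStep
  refine Measurable.ite ?_ ?_ measurable_const
  · exact (((measurable_fst.norm) (measurableSet_singleton 1)).inter
      (measurableSet_le (measurable_fst.sub_const vstar).norm measurable_const)).inter
      (measurableSet_le hΓ'.norm measurable_const)
  · exact measurable_sphereProj.comp (measurable_fst.sub (hΓ'.const_smul η))

/-- The linear functional `g ↦ ⟪g - ⟪v, g⟫ v, w⟫`, the pairing of the tangential part of `g`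
with `w`. -/
noncomputable def tangentialInner (v w : Vec d) : Vec d →L[ℝ] ℝ :=
  innerSL ℝ (w - (inner ℝ v w : ℝ) • v)

theorem tangentialInner_apply (v w g : Vec d) :
    tangentialInner v w g = inner ℝ (g - (inner ℝ v g : ℝ) • v) w := by
  simp only [tangentialInner, innerSL_apply_apply, inner_sub_left, real_inner_smul_left]
  rw [real_inner_comm]
  ring

theorem abs_tangentialInner_le {v : Vec d} (hv : ‖v‖ = 1) (w g : Vec d) :
    |tangentialInner v w g| ≤ ‖g‖ * ‖w‖ := by
  rw [tangentialInner_apply]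
  refine (abs_real_inner_le_norm _ _).trans ?_
  gcongr
  exact norm_tangential_le hv g

variable {ν : Measure Z} [IsProbabilityMeasure ν] {f : Z → Vec d}

theorem integrable_of_norm_sq (hf : Measurable f) (hint : Integrable (fun z => ‖f z‖ ^ 2) ν) :
    Integrable f ν := by
  refine Integrable.mono' (hint.add (integrable_const 1)) hf.aestronglyMeasurable
    (Filter.Eventually.of_forall fun z => ?_)
  simp only [Pi.add_apply]
  nlinarith [sq_nonneg (‖f z‖ - 1)]

open Classical in
/-- Truncating the stochastic vector at level `B` costs only a small part of the drift. -/
theorem le_integral_tangentialInner_truncation (hf : Measurable f)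
    (hint : Integrable (fun z => ‖f z‖ ^ 2) ν) {S ε m B : ℝ}
    (hsq : ∫ z, ‖f z‖ ^ 2 ∂ν ≤ 2 * S) (hε : 0 < ε) (hm : 0 < m)
    (htail : ν {z | B < ‖f z‖} ≤ ENNReal.ofReal (2 * ε)) {u w : Vec d} (hu : ‖u‖ = 1)
    (hdrift : 3 / 4 * m * ‖w‖ ^ 2 ≤ tangentialInner u w (∫ z, f z ∂ν)) :
    5 / 8 * m * ‖w‖ ^ 2 - 8 * ε * S / m ≤
      ∫ z, tangentialInner u w (if ‖f z‖ ≤ B then f z else 0) ∂ν := by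
  have hfi := integrable_of_norm_sq hf hint
  have hbad : MeasurableSet {z | B < ‖f z‖} := measurableSet_lt measurable_const hf.norm
  set k : ℝ := m / (16 * ε) with hk
  have hk0 : 0 < k := by positivity
  have hgi : Integrable (fun z => tangentialInner u w (if ‖f z‖ ≤ B then f z else 0)) ν := by
    refine Integrable.mono' (hfi.norm.mul_const ‖w‖) ?_ (Filter.Eventually.of_forall fun z => ?_)
    · exact ((tangentialInner u w).measurable.comp (Measurable.ite
        (measurableSet_le hf.norm measurable_const) hf measurable_const)).aestronglyMeasurable
    · refine (abs_tangentialInner_le hu w _).trans ?_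
      split_ifs
      · exact le_rfl
      · rw [norm_zero, zero_mul]
        positivity
  have hindi : Integrable ({z | B < ‖f z‖}.indicator fun _ => k * ‖w‖ ^ 2) ν :=
    (integrable_const _).indicator hbad
  -- The weight `k` in `a b ≤ a² / (4 k) + k b²` balances the second moment against the tail.
  have hpt : ∀ z, tangentialInner u w (f z) ≤
      tangentialInner u w (if ‖f z‖ ≤ B then f z else 0) +
        (‖f z‖ ^ 2 * (4 * ε / m) + {z | B < ‖f z‖}.indicator (fun _ => k * ‖w‖ ^ 2) z) := by
    intro z
    by_cases hz : ‖f z‖ ≤ B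
    · rw [if_pos hz, Set.indicator_of_notMem (by simpa using hz)]
      have : 0 ≤ ‖f z‖ ^ 2 * (4 * ε / m) := by positivity
      linarith
    · rw [if_neg hz, Set.indicator_of_mem (by simpa using hz), map_zero, zero_add]
      refine (le_of_abs_le (abs_tangentialInner_le hu w _)).trans ?_
      have h4 : 4 * ε / m = 1 / (4 * k) := by
        rw [hk]
        field_simp
        norm_num
      rw [h4]
      have h5 : ‖f z‖ ^ 2 * (1 / (4 * k)) + k * ‖w‖ ^ 2 - ‖f z‖ * ‖w‖ =
          (‖f z‖ - 2 * k * ‖w‖) ^ 2 / (4 * k) := by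
        field_simp
        ring
      have h6 : 0 ≤ (‖f z‖ - 2 * k * ‖w‖) ^ 2 / (4 * k) := by positivity
      linarith
  have hle := integral_mono ((tangentialInner u w).integrable_comp hfi)
    (hgi.add ((hint.mul_const (4 * ε / m)).add hindi)) hpt
  rw [ContinuousLinearMap.integral_comp_comm _ hfi] at hle
  simp only [Pi.add_apply] at hle
  rw [integral_add hgi (by exact (hint.mul_const (4 * ε / m)).add hindi),
    integral_add (hint.mul_const (4 * ε / m)) hindi, integral_mul_const,
    integral_indicator_const _ hbad, smul_eq_mul] at hle
  have htail' : ν.real {z | B < ‖f z‖} ≤ 2 * ε :=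
    ENNReal.toReal_le_of_le_ofReal (by positivity) htail
  have h7 : ν.real {z | B < ‖f z‖} * (k * ‖w‖ ^ 2) ≤ 1 / 8 * m * ‖w‖ ^ 2 := by
    calc _ ≤ 2 * ε * (k * ‖w‖ ^ 2) := by gcongr
      _ = _ := by
        rw [hk]
        field_simp
        ring
  have h8 : (∫ z, ‖f z‖ ^ 2 ∂ν) * (4 * ε / m) ≤ 8 * ε * S / m := by
    calc _ ≤ 2 * S * (4 * ε / m) := by gcongr
      _ = _ := by ring
  linarith

open Classical in
/-- The exponential moments of the squared distance contract along one step from a point where the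
drift condition holds. -/
theorem lintegral_exp_step_le (hf : Measurable f)
    (hint : Integrable (fun z => ‖f z‖ ^ 2) ν) {S ε m B η K s : ℝ}
    (hsq : ∫ z, ‖f z‖ ^ 2 ∂ν ≤ 2 * S) (hε : 0 < ε) (hm : 0 < m)
    (htail : ν {z | B < ‖f z‖} ≤ ENNReal.ofReal (2 * ε)) {u p : Vec d} (hu : ‖u‖ = 1)
    (hp : ‖p‖ = 1) (hup : ‖u - p‖ ≤ 1)
    (hdrift : 3 / 4 * m * ‖u - p‖ ^ 2 ≤ tangentialInner u (u - p) (∫ z, f z ∂ν))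
    (hη : 0 < η) (hB : 0 < B) (hηB : η * B ≤ 1 / 2)
    (hK : 8 * η ^ 2 * B ^ 2 + 16 * η * ε * S / m = η * m * K) (hs0 : 0 ≤ s)
    (hs : s ≤ m / (8 * η * B ^ 2)) :
    ∫⁻ z, ENNReal.ofReal (Real.exp
        (s * (‖(if ‖f z‖ ≤ B then sphereProj (u - η • f z) else p) - p‖ ^ 2 - K))) ∂ν ≤
      ENNReal.ofReal (Real.exp (s * (1 - η * m) * (‖u - p‖ ^ 2 - K))) := by
  set w : Vec d := u - p with hw
  set g : Z → Vec d := fun z => if ‖f z‖ ≤ B then f z else 0 with hg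
  have hgm : Measurable g :=
    Measurable.ite (measurableSet_le hf.norm measurable_const) hf measurable_const
  have hgB : ∀ z, ‖g z‖ ≤ B := by
    intro z
    simp only [hg]
    split_ifs with hz
    · exact hz
    · rw [norm_zero]
      exact hB.le
  set Y : Z → ℝ := fun z => -(2 * η) * tangentialInner u w (g z) with hY
  have hYm : Measurable Y := ((tangentialInner u w).measurable.comp hgm).const_mul _
  have hYb : ∀ z, |Y z| ≤ 2 * η * B * ‖w‖ := by
    intro z
    rw [hY, abs_mul, abs_neg, abs_of_pos (by positivity : 0 < 2 * η), mul_assoc (2 * η)]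
    refine mul_le_mul_of_nonneg_left ((abs_tangentialInner_le hu w _).trans ?_) (by positivity)
    exact mul_le_mul_of_nonneg_right (hgB z) (norm_nonneg _)
  have hYmean : ∫ z, Y z ∂ν ≤ -(2 * η) * (5 / 8 * m * ‖w‖ ^ 2 - 8 * ε * S / m) := by
    rw [hY, integral_const_mul]
    exact mul_le_mul_of_nonpos_left
      (le_integral_tangentialInner_truncation hf hint hsq hε hm htail hu hdrift) (by linarith)
  have hexp := lintegral_exp_mul_le hYm hYb hYmean hs0
  have hpt : ∀ z, ‖(if ‖f z‖ ≤ B then sphereProj (u - η • f z) else p) - p‖ ^ 2 ≤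
      ‖w‖ ^ 2 + Y z + 8 * η ^ 2 * B ^ 2 := by
    intro z
    by_cases hz : ‖f z‖ ≤ B
    · have h1 := norm_sphereProj_step_sq_le (g := f z) hu hp hη.le
        ((mul_le_mul_of_nonneg_left hz hη.le).trans hηB) hup
      have h2 : 8 * η ^ 2 * ‖f z‖ ^ 2 ≤ 8 * η ^ 2 * B ^ 2 := by gcongr
      simp only [hY, hg, if_pos hz]
      rw [tangentialInner_apply]
      linarith
    · simp only [hY, hg, if_neg hz, sub_self, norm_zero, map_zero, mul_zero, add_zero]
      have : 0 ≤ ‖w‖ ^ 2 + 8 * η ^ 2 * B ^ 2 := by positivity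
      simpa using this
  calc _ ≤ ∫⁻ z, ENNReal.ofReal (Real.exp (s * (‖w‖ ^ 2 + 8 * η ^ 2 * B ^ 2 - K))) *
          ENNReal.ofReal (Real.exp (s * Y z)) ∂ν := by
        refine lintegral_mono fun z => ?_
        rw [← ENNReal.ofReal_mul (Real.exp_pos _).le, ← Real.exp_add, ← mul_add]
        refine ENNReal.ofReal_le_ofReal (Real.exp_le_exp.2 ?_)
        refine mul_le_mul_of_nonneg_left ?_ hs0
        linarith [hpt z]
    _ = ENNReal.ofReal (Real.exp (s * (‖w‖ ^ 2 + 8 * η ^ 2 * B ^ 2 - K))) *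
          ∫⁻ z, ENNReal.ofReal (Real.exp (s * Y z)) ∂ν :=
        lintegral_const_mul' _ _ ENNReal.ofReal_ne_top
    _ ≤ _ := by
        refine (mul_le_mul_right hexp _).trans ?_
        rw [← ENNReal.ofReal_mul (Real.exp_pos _).le, ← Real.exp_add]
        refine ENNReal.ofReal_le_ofReal (Real.exp_le_exp.2 ?_)
        -- The variance proxy uses up a quarter of `η m ‖w‖²`, which the drift can afford.
        have h1 : s * (2 * η ^ 2 * B ^ 2 * ‖w‖ ^ 2) ≤ η * m / 4 * ‖w‖ ^ 2 := by
          calc s * (2 * η ^ 2 * B ^ 2 * ‖w‖ ^ 2)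
              ≤ m / (8 * η * B ^ 2) * (2 * η ^ 2 * B ^ 2 * ‖w‖ ^ 2) := by gcongr
            _ = _ := by
              field_simp
              ring
        have h2 := mul_le_mul_of_nonneg_left h1 hs0
        have h3 : s * (8 * η ^ 2 * B ^ 2 + 16 * η * ε * S / m) = s * (η * m * K) := by rw [hK]
        have h4 : 16 * η * ε * S / m = 2 * η * (8 * ε * S / m) := by ring
        rw [h4] at h3
        nlinarith

end Tamed

section TamedChain

variable {d : ℕ} {Z Ω : Type*} [MeasurableSpace Z] [MeasurableSpace Ω] {P : Measure Ω}
  [IsProbabilityMeasure P] {ν : Measure Z} {ζ : ℕ → Ω → Z} {Γ : Vec d → Z → Vec d}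
  {vstar v₀ : Vec d} {α V η R m K L : ℝ}

/-- The contraction of exponential moments for the tamed transition, from an arbitrary point: the
jumps to `vstar` only decrease the distance to `vstar`. -/
theorem lintegral_exp_tamedStep_le [IsProbabilityMeasure ν]
    (hΓ : Measurable (Function.uncurry Γ)) (hα : 0 < α) (hV : 0 < V)
    (hW : SubWeibull ν Γ α V) (hvs : ‖vstar‖ = 1) (hm : 0 < m) (hη : 0 < η) (hR : R ≤ 1)
    (hL : 0 < L) (hηm : η * m ≤ 1) (hηB : η * (V * L ^ (1 / α)) ≤ 1 / 2) (hK0 : 0 ≤ K)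
    (hK : 8 * η ^ 2 * (V * L ^ (1 / α)) ^ 2 + 16 * η * Real.exp (-L) * (V ^ 2 * G α) / m =
      η * m * K)
    (hdrift : ∀ u : Vec d, ‖u‖ = 1 → ‖u - vstar‖ ≤ R →
      3 / 4 * m * ‖u - vstar‖ ^ 2 ≤ tangentialInner u (u - vstar) (∫ z, Γ u z ∂ν))
    (u : Vec d) :
    ∀ s ∈ Set.Icc 0 (m / (8 * η * (V * L ^ (1 / α)) ^ 2)),
      ∫⁻ z, ENNReal.ofReal (Real.exp (s *
          (‖tamedStep Γ η R (V * L ^ (1 / α)) vstar u z - vstar‖ ^ 2 - K))) ∂ν ≤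
        ENNReal.ofReal (Real.exp (s * (1 - η * m) * (‖u - vstar‖ ^ 2 - K))) := by
  intro s hs
  by_cases hu : ‖u‖ = 1 ∧ ‖u - vstar‖ ≤ R
  · have hf : Measurable (Γ u) := hΓ.of_uncurry_left
    have hWu := hW u (mem_sphere_zero_iff_norm.2 hu.1)
    have hsq := integral_norm_sq_le hf hα hV hWu
    simp only [tamedStep, hu, and_self, true_and]
    exact lintegral_exp_step_le hf (integrable_norm_sq hf hα hV hWu)
      (hsq.trans_eq (by ring)) (Real.exp_pos _) hm (measure_norm_gt_le hf hα hV hWu hL.le) hu.1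
      hvs (hu.2.trans hR) (hdrift u hu.1 hu.2) hη (by positivity) hηB hK hs.1 hs.2
  · simp only [tamedStep, hu, false_and, if_false, sub_self, norm_zero, lintegral_const,
      measure_univ, mul_one]
    refine ENNReal.ofReal_le_ofReal (Real.exp_le_exp.2 ?_)
    have h1 : 0 ≤ (1 - η * m) * ‖u - vstar‖ ^ 2 :=
      mul_nonneg (by linarith) (sq_nonneg _)
    have h2 : 0 ≤ η * m * K := by positivity
    rw [mul_assoc]
    refine mul_le_mul_of_nonneg_left ?_ hs.1
    linarith

/-- If the region of radius `R` is large enough to absorb the fluctuations, then with probability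
at least `1 - 3 T exp (-L)` the SSGD iterates stay in it up to time `T`, and the squared distance
to `vstar` contracts geometrically up to these fluctuations. -/
theorem exists_event_norm_iterate_sub_sq_le
    (hζ : ∀ t, Measurable (ζ t)) (hind : iIndepFun ζ P) (hlaw : ∀ t, P.map (ζ t) = ν)
    (hΓ : Measurable (Function.uncurry Γ)) (hα : 0 < α) (hV : 0 < V)
    (hW : SubWeibull ν Γ α V) (hvs : ‖vstar‖ = 1) (hv₀ : ‖v₀‖ = 1) (hm : 0 < m) (hη : 0 < η)
    (hR0 : 0 ≤ R) (hR : R ≤ 1)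
    (hL : 0 < L) (hηm : η * m ≤ 1) (hηB : η * (V * L ^ (1 / α)) ≤ 1 / 2) (hK0 : 0 ≤ K)
    (hK : 8 * η ^ 2 * (V * L ^ (1 / α)) ^ 2 + 16 * η * Real.exp (-L) * (V ^ 2 * G α) / m =
      η * m * K)
    (hdrift : ∀ u : Vec d, ‖u‖ = 1 → ‖u - vstar‖ ≤ R →
      3 / 4 * m * ‖u - vstar‖ ^ 2 ≤ tangentialInner u (u - vstar) (∫ z, Γ u z ∂ν))
    (hR2 : ‖v₀ - vstar‖ ^ 2 + K + L / (m / (8 * η * (V * L ^ (1 / α)) ^ 2)) ≤ R ^ 2) (T : ℕ) :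
    ∃ H : Set Ω, MeasurableSet H ∧ P Hᶜ ≤ ENNReal.ofReal (3 * T * Real.exp (-L)) ∧
      ∀ ω ∈ H, ‖SSGD.iterate Γ η v₀ (fun t => ζ t ω) T - vstar‖ ^ 2 ≤
        (1 - η * m) ^ T * ‖v₀ - vstar‖ ^ 2 + K +
          L / (m / (8 * η * (V * L ^ (1 / α)) ^ 2)) := by
  have hν : IsProbabilityMeasure ν :=
    hlaw 0 ▸ Measure.isProbabilityMeasure_map (hζ 0).aemeasurable
  set B : ℝ := V * L ^ (1 / α) with hB
  have hB0 : 0 < B := by positivity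
  set θ : ℝ := m / (8 * η * B ^ 2) with hθ
  have hθ0 : 0 < θ := by positivity
  set β : ℝ := 1 - η * m with hβ
  have hβ0 : 0 ≤ β := by linarith
  have hβ1 : β ≤ 1 := by
    have : 0 < η * m := by positivity
    linarith
  set Φ : Vec d → Z → Vec d := tamedStep Γ η R B vstar with hΦdef
  have hΦ : Measurable (Function.uncurry Φ) := measurable_tamedStep hΓ η R B vstar
  set x : Ω → ℕ → Vec d := fun ω t => chain Φ v₀ (fun i => ζ i ω) t with hx
  have hxm : ∀ t, Measurable fun ω => x ω t := fun t => measurable_chain hΦ hζ t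
  set A : Vec d → ℝ := fun u => ‖u - vstar‖ ^ 2 with hA
  have hAm : Measurable A := by fun_prop
  set far : ℕ → Set Ω := fun t =>
    {ω | β ^ (t + 1) * A v₀ + K + L / θ ≤ A (x ω (t + 1))} with hfar
  set big : ℕ → Set Ω := fun t =>
    {ω | ‖x ω t‖ = 1 ∧ B < ‖Γ (x ω t) (ζ (t + 1) ω)‖} with hbig
  have hΓm : ∀ t, Measurable fun ω => Γ (x ω t) (ζ (t + 1) ω) := fun t =>
    hΓ.comp ((hxm t).prodMk (hζ (t + 1)))
  have hfar_meas : ∀ t, MeasurableSet (far t) := fun t =>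
    measurableSet_le measurable_const (hAm.comp (hxm (t + 1)))
  have hbig_meas : ∀ t, MeasurableSet (big t) := fun t =>
    ((hxm t).norm (measurableSet_singleton 1)).inter
      (measurableSet_lt measurable_const (hΓm t).norm)
  have hfar_le : ∀ t, P (far t) ≤ ENNReal.ofReal (Real.exp (-L)) := fun t =>
    measure_chain_ge_le hΦ hζ hind hlaw hAm hβ0 hβ1 hK0 hθ0
      (lintegral_exp_tamedStep_le hΓ hα hV hW hvs hm hη hR hL hηm hηB hK0 hK hdrift) (t + 1) L
  have hbig_le : ∀ t, P (big t) ≤ ENNReal.ofReal (2 * Real.exp (-L)) := by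
    intro t
    set S : Set (Vec d × Z) := {y | ‖y.1‖ = 1 ∧ B < ‖Γ y.1 y.2‖} with hS
    have hSm : MeasurableSet S :=
      ((measurable_fst.norm) (measurableSet_singleton 1)).inter
        (measurableSet_lt measurable_const (Measurable.norm hΓ))
    have h1 := lintegral_chain (x₀ := v₀) hΦ hζ hind hlaw
      (h := fun u z => S.indicator 1 (u, z)) (measurable_one.indicator hSm) t
    have h2 : P (big t) = ∫⁻ ω, S.indicator 1 (x ω t, ζ (t + 1) ω) ∂P := by
      rw [← lintegral_indicator_one (hbig_meas t)]
      rfl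
    rw [h2]
    refine h1.trans_le ?_
    calc _ ≤ ∫⁻ _ : Ω, ENNReal.ofReal (2 * Real.exp (-L)) ∂P := by
          refine lintegral_mono fun ω => ?_
          by_cases hu : ‖x ω t‖ = 1
          · have hf : Measurable (Γ (x ω t)) := hΓ.of_uncurry_left
            refine le_trans ?_ (measure_norm_gt_le hf hα hV
              (hW _ (mem_sphere_zero_iff_norm.2 hu)) hL.le)
            rw [← lintegral_indicator_one (measurableSet_lt measurable_const hf.norm)]
            refine lintegral_mono fun z => ?_
            by_cases hz : (x ω t, z) ∈ S
            · have hz' : z ∈ {z | V * L ^ (1 / α) < ‖Γ (x ω t) z‖} := hz.2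
              rw [Set.indicator_of_mem hz']
              exact (Set.indicator_of_mem hz _).le
            · exact (Set.indicator_of_notMem hz _).trans_le zero_le
          · have : ∀ z, S.indicator (1 : Vec d × Z → ENNReal) (x ω t, z) = 0 := fun z =>
              Set.indicator_of_notMem (fun h => hu h.1) _
            simp only [hx] at this
            simp [this]
      _ = _ := by simp
  refine ⟨(⋃ t ∈ Finset.range T, (far t ∪ big t))ᶜ, ?_, ?_, ?_⟩
  · exact (Finset.measurableSet_biUnion _ fun t _ => (hfar_meas t).union (hbig_meas t)).compl
  · rw [compl_compl]
    calc _ ≤ ∑ t ∈ Finset.range T, P (far t ∪ big t) := measure_biUnion_finset_le _ _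
      _ ≤ ∑ _t ∈ Finset.range T, ENNReal.ofReal (3 * Real.exp (-L)) := by
          refine Finset.sum_le_sum fun t _ => ?_
          refine (measure_union_le _ _).trans ((add_le_add (hfar_le t) (hbig_le t)).trans_eq ?_)
          rw [← ENNReal.ofReal_add (by positivity) (by positivity)]
          ring_nf
      _ = _ := by
          rw [Finset.sum_const, Finset.card_range, nsmul_eq_mul, ← ENNReal.ofReal_natCast,
            ← ENNReal.ofReal_mul (by positivity)]
          ring_nf
  · intro ω hω
    have hω' : ∀ t < T, A (x ω (t + 1)) < β ^ (t + 1) * A v₀ + K + L / θ ∧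
        (‖x ω t‖ = 1 → ‖Γ (x ω t) (ζ (t + 1) ω)‖ ≤ B) := by
      intro t ht
      have h1 : ω ∉ far t ∪ big t := fun h =>
        hω (Set.mem_biUnion (Finset.mem_coe.2 (Finset.mem_range.2 ht)) h)
      constructor
      · by_contra hc
        exact h1 (Or.inl (not_lt.1 hc))
      · intro hn
        by_contra hc
        exact h1 (Or.inr ⟨hn, not_le.1 hc⟩)
    have hLθ : 0 < L / θ := by positivity
    have hind' : ∀ t ≤ T, x ω t = SSGD.iterate Γ η v₀ (fun i => ζ i ω) t ∧ ‖x ω t‖ = 1 ∧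
        A (x ω t) ≤ β ^ t * A v₀ + K + L / θ := by
      intro t
      induction t with
      | zero =>
        intro _
        refine ⟨rfl, hv₀, ?_⟩
        simp only [hx, chain, pow_zero, one_mul]
        linarith
      | succ t ih =>
        intro ht
        obtain ⟨h1, h2, h3⟩ := ih (by omega)
        obtain ⟨h4, h5⟩ := hω' t ht
        have h6 := h5 h2
        have h7 : ‖x ω t - vstar‖ ≤ R := by
          refine (sq_le_sq₀ (norm_nonneg _) hR0).1 (h3.trans (le_trans ?_ hR2))
          have : β ^ t * A v₀ ≤ A v₀ :=
            mul_le_of_le_one_left (sq_nonneg _) (pow_le_one₀ hβ0 hβ1)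
          linarith
        have h8 : x ω (t + 1) =
            sphereProj (x ω t - η • Γ (x ω t) (ζ (t + 1) ω)) := by
          change tamedStep Γ η R B vstar (x ω t) (ζ (t + 1) ω) = _
          rw [tamedStep, if_pos ⟨⟨h2, h7⟩, h6⟩]
        refine ⟨?_, ?_, h4.le⟩
        · rw [h8, h1]
          rfl
        · rw [h8]
          refine norm_sphereProj fun h0 => ?_
          have h9 : ‖x ω t‖ = ‖η • Γ (x ω t) (ζ (t + 1) ω)‖ :=
            congrArg norm (sub_eq_zero.1 h0)
          rw [h2, norm_smul, Real.norm_of_nonneg hη.le] at h9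
          linarith [mul_le_mul_of_nonneg_left h6 hη.le]
    obtain ⟨h1, -, h3⟩ := hind' T le_rfl
    rw [h1] at h3
    exact h3

end TamedChain

/-! ### The finite-sample bound -/

section FiniteSample

variable {d : ℕ} {Z : Type*} [MeasurableSpace Z] {ν : Measure Z} [IsProbabilityMeasure ν]

theorem norm_integral_sq_le {f : Z → Vec d} (hf : Measurable f)
    (hint : Integrable (fun z => ‖f z‖ ^ 2) ν) :
    ‖∫ z, f z ∂ν‖ ^ 2 ≤ ∫ z, ‖f z‖ ^ 2 ∂ν := by
  have hfi := integrable_of_norm_sq hf hint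
  set a : ℝ := ‖∫ z, f z ∂ν‖ with ha
  have h1 : ∫ z, 2 * a * ‖f z‖ ∂ν ≤ ∫ z, (a ^ 2 + ‖f z‖ ^ 2) ∂ν :=
    integral_mono (hfi.norm.const_mul _) ((integrable_const _).add hint) fun z => by
      simp only
      nlinarith [sq_nonneg (a - ‖f z‖)]
  rw [integral_const_mul, integral_add (integrable_const _) hint, integral_const,
    probReal_univ, one_smul] at h1
  have h2 : a * a ≤ a * ∫ z, ‖f z‖ ∂ν :=
    mul_le_mul_of_nonneg_left (norm_integral_le_integral_norm f) (norm_nonneg _)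
  nlinarith

/-- The drift at a point is bounded by the size of the stochastic vector, so the drift condition
limits the distance to the minimizer. -/
theorem norm_sq_le_of_drift {f : Z → Vec d} (hf : Measurable f)
    (hint : Integrable (fun z => ‖f z‖ ^ 2) ν) {S m : ℝ} (hm : 0 < m)
    (hsq : ∫ z, ‖f z‖ ^ 2 ∂ν ≤ 2 * S) {u w : Vec d} (hu : ‖u‖ = 1)
    (hdrift : 3 / 4 * m * ‖w‖ ^ 2 ≤ tangentialInner u w (∫ z, f z ∂ν)) :
    ‖w‖ ^ 2 ≤ 4 * S / m ^ 2 := by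
  have h1 := (norm_integral_sq_le hf hint).trans hsq
  have h2 := hdrift.trans (le_of_abs_le (abs_tangentialInner_le hu w _))
  set a : ℝ := ‖∫ z, f z ∂ν‖ with ha
  have ha0 : 0 ≤ a := norm_nonneg _
  rw [le_div_iff₀ (by positivity)]
  rcases (norm_nonneg w).eq_or_lt with h0 | h0
  · rw [← h0]
    nlinarith
  · have h3 : 3 / 4 * m * ‖w‖ ≤ a := by
      refine le_of_mul_le_mul_right ?_ h0
      linarith
    have h4 : (3 / 4 * m * ‖w‖) ^ 2 ≤ a ^ 2 := by gcongr
    nlinarith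

end FiniteSample

/-! ### Step-size arithmetic -/

section StepSize

variable {α V L m η ρ δ ε A c Λ : ℝ} {T : ℕ}

theorem sq_rpow_one_div (hL : 0 ≤ L) : (L ^ (1 / α)) ^ 2 = L ^ (2 / α) := by
  rw [← Real.rpow_natCast (L ^ (1 / α)), ← Real.rpow_mul hL]
  congr 1
  push_cast
  ring

theorem rpow_neg_add_two_div (hα : 0 < α) (hL : 0 ≤ L) :
    L ^ (-((α + 2) / α)) = (L * L ^ (2 / α))⁻¹ := by
  rw [Real.rpow_neg hL, ← Real.rpow_one_add' hL (by positivity)]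
  congr 2
  field_simp

theorem sq_rpow_add_two_div (hα : 0 < α) (hL : 0 ≤ L) :
    (L ^ ((α + 2) / (2 * α))) ^ 2 = L * L ^ (2 / α) := by
  rw [← Real.rpow_natCast, ← Real.rpow_mul hL, ← Real.rpow_one_add' hL (by positivity)]
  congr 1
  push_cast
  field_simp

/-- The squared stationary radius `η V² A Λ / m` is small compared with the squared radius
`(m / ρ)²` on which the drift dominates the cubic error. -/
theorem noise_le_sq_curvature_radius (hV : 0 < V) (hm : 0 < m) (hρ : 0 < ρ) (hA : 0 < A)
    (hΛ : 0 < Λ) (hη : η ≤ m ^ 3 / (2 ^ 24 * A * V ^ 2 * ρ ^ 2) * Λ⁻¹) :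
    η * (V ^ 2 * A) * Λ / m ≤ (m / (2 ^ 12 * ρ)) ^ 2 := by
  calc η * (V ^ 2 * A) * Λ / m
      ≤ m ^ 3 / (2 ^ 24 * A * V ^ 2 * ρ ^ 2) * Λ⁻¹ * (V ^ 2 * A) * Λ / m := by gcongr
    _ = _ := by field_simp

/-- The squared stationary radius is small compared with the squared radius `δ²` of the region of
smoothness. -/
theorem noise_le_sq_smooth_radius (hV : 0 < V) (hm : 0 < m) (hA : 0 < A)
    (hΛ : 0 < Λ) (hη : η ≤ m * δ ^ 2 / (2 ^ 16 * A * V ^ 2) * Λ⁻¹) :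
    η * (V ^ 2 * A) * Λ / m ≤ (δ / 2 ^ 8) ^ 2 := by
  calc η * (V ^ 2 * A) * Λ / m
      ≤ m * δ ^ 2 / (2 ^ 16 * A * V ^ 2) * Λ⁻¹ * (V ^ 2 * A) * Λ / m := by gcongr
    _ = _ := by field_simp

/-- Bound on the stationary level plus the deviation `L / θ` of the exponential Markov
inequality, for `B² = V² W`. -/
theorem stationary_level_le {B W : ℝ} (hB : B ^ 2 = V ^ 2 * W) (hV : 0 < V) (hm : 0 < m)
    (hη : 0 < η) (hA : 1 ≤ A) (hL : 1 ≤ L) (hW : 1 ≤ W) (hε : 8 * ε ≤ η * m) :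
    (8 * η ^ 2 * B ^ 2 + 16 * η * ε * (V ^ 2 * A) / m) / (η * m) + L / (m / (8 * η * B ^ 2)) ≤
      18 * (η * (V ^ 2 * A) * (L * W) / m) := by
  have h1 : (8 * η ^ 2 * B ^ 2 + 16 * η * ε * (V ^ 2 * A) / m) / (η * m) =
      8 * (η * (V ^ 2 * 1) * (1 * W) / m) + 2 * (8 * ε * (V ^ 2 * A) / m / m) := by
    rw [hB]
    field_simp
    ring
  have h2 : η * (V ^ 2 * 1) * (1 * W) / m ≤ η * (V ^ 2 * A) * (L * W) / m := by gcongr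
  have h3 : 8 * ε * (V ^ 2 * A) / m / m ≤ η * (V ^ 2 * A) * (L * W) / m := by
    calc 8 * ε * (V ^ 2 * A) / m / m ≤ η * m * (V ^ 2 * A) / m / m := by gcongr
      _ = η * (V ^ 2 * A) * (1 * 1) / m := by field_simp
      _ ≤ _ := by gcongr
  have h4 : L / (m / (8 * η * B ^ 2)) = 8 * (η * (V ^ 2 * 1) * (L * W) / m) := by
    rw [hB]
    field_simp
  have h5 : η * (V ^ 2 * 1) * (L * W) / m ≤ η * (V ^ 2 * A) * (L * W) / m := by gcongr
  rw [h1, h4]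
  linarith

theorem truncated_step_le {B W : ℝ} (hB0 : 0 ≤ B) (hB : B ^ 2 = V ^ 2 * W) (hV : 0 < V)
    (hm : 0 < m) (hη : 0 < η) (hηm : η * m ≤ 1) (hA : 1 ≤ A) (hL : 1 ≤ L) (hW : 1 ≤ W)
    (hN : η * (V ^ 2 * A) * (L * W) / m ≤ (1 / 2) ^ 2) : η * B ≤ 1 / 2 := by
  refine (sq_le_sq₀ (by positivity) (by norm_num)).1 ?_
  calc (η * B) ^ 2 = η * m * (η * (V ^ 2 * 1) * (1 * W) / m) := by
        rw [mul_pow, hB]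
        field_simp
    _ ≤ 1 * (η * (V ^ 2 * A) * (L * W) / m) := by gcongr
    _ ≤ (1 / 2) ^ 2 := by rwa [one_mul]

theorem sixty_nine_div_hundred_le_log (hT : (2 : ℝ) ≤ T) : 69 / 100 ≤ Real.log T := by
  have h1 := Real.log_two_gt_d9
  have h2 := Real.log_le_log (by norm_num) hT
  linarith

theorem one_sub_pow_le_log_div {x : ℝ} (hT : (2 : ℝ) ≤ T) (hx1 : x ≤ 1)
    (hx : Real.log T / T ≤ x) : (1 - x) ^ T ≤ 3 / 2 * (Real.log T / T) := by
  have hlog := sixty_nine_div_hundred_le_log hT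
  calc (1 - x) ^ T ≤ Real.exp (-x) ^ T :=
        pow_le_pow_left₀ (by linarith) (Real.one_sub_le_exp_neg _) T
    _ = Real.exp (-(x * T)) := by
        rw [← Real.exp_nat_mul]
        ring_nf
    _ ≤ Real.exp (-Real.log T) := by
        rw [div_le_iff₀ (by linarith)] at hx
        gcongr
    _ = 1 / T := by rw [Real.exp_neg, Real.exp_log (by linarith), one_div]
    _ ≤ 3 / 2 * Real.log T / T := by
        gcongr
        linarith
    _ = _ := by ring

/-- The decay of the initial error and the stationary level are both of order `log T / T`. -/
theorem final_level_le {a x : ℝ} (hc : 1 ≤ c) (hA : 1 ≤ A) (hΛ : 1 ≤ Λ)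
    (hV : 0 < V) (hm : 0 < m) (hT : (2 : ℝ) ≤ T) (hη : η ≤ c * (Real.log T / (m * T)))
    (hx0 : 0 ≤ x) (hx : x ≤ 3 / 2 * (Real.log T / T)) (ha : a ≤ 4 * (V ^ 2 * A) / m ^ 2) :
    x * a + 18 * (η * (V ^ 2 * A) * Λ / m) ≤
      (5 * c * (A * V / m)) ^ 2 * Λ * (Real.log T / T) := by
  have hlog := sixty_nine_div_hundred_le_log hT
  have hlT : 0 ≤ Real.log T / T := by positivity
  have h1 : η * (V ^ 2 * A) * Λ / m ≤ c * (V ^ 2 * A * Λ / m ^ 2 * (Real.log T / T)) := by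
    calc η * (V ^ 2 * A) * Λ / m ≤ c * (Real.log T / (m * T)) * (V ^ 2 * A) * Λ / m := by
          gcongr
      _ = _ := by field_simp
  have h2 : x * a ≤ 6 * (c * (V ^ 2 * A * Λ / m ^ 2 * (Real.log T / T))) := by
    calc x * a ≤ x * (4 * (V ^ 2 * A) / m ^ 2) := by gcongr
      _ ≤ 3 / 2 * (Real.log T / T) * (4 * (V ^ 2 * A) / m ^ 2) := by gcongr
      _ = 6 * (1 * (V ^ 2 * A * 1 / m ^ 2 * (Real.log T / T))) := by ring
      _ ≤ _ := by gcongr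
  calc _ ≤ 24 * (c * (V ^ 2 * A * Λ / m ^ 2 * (Real.log T / T))) := by linarith
    _ ≤ 25 * (c * c * (V ^ 2 * (A * A) * Λ / m ^ 2 * (Real.log T / T))) := by
        gcongr
        · norm_num
        · exact le_mul_of_one_le_left (by linarith) hc
        · exact le_mul_of_one_le_left (by linarith) hA
    _ = _ := by ring

/-- The region on which the drift is available contains the ball reached from the warm start. -/
theorem sq_add_noise_le_sq_min {r N : ℝ} (hr : 0 ≤ r)
    (hr1 : r ≤ m / (2 ^ 5 * ρ)) (hr2 : r ≤ δ / 2)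
    (hN1 : N ≤ (m / (2 ^ 12 * ρ)) ^ 2) (hN2 : N ≤ (δ / 2 ^ 8) ^ 2) :
    r ^ 2 + 18 * N ≤ min (m / (16 * ρ)) (9 / 16 * δ) ^ 2 := by
  have h1 : r ^ 2 + 18 * N ≤ (m / (16 * ρ)) ^ 2 := by
    have h2 : r ^ 2 ≤ (m / (2 ^ 5 * ρ)) ^ 2 := by gcongr
    have h3 : 0 ≤ (m / ρ) ^ 2 := sq_nonneg _
    have h4 : ∀ a : ℝ, (m / (a * ρ)) ^ 2 = (m / ρ) ^ 2 / a ^ 2 := fun a => by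
      rw [div_mul_eq_div_div_swap, div_pow]
    rw [h4] at h2 hN1 ⊢
    linarith
  have h5 : r ^ 2 + 18 * N ≤ (9 / 16 * δ) ^ 2 := by
    have h2 : r ^ 2 ≤ (δ / 2) ^ 2 := by gcongr
    nlinarith [sq_nonneg δ]
  rcases min_choice (m / (16 * ρ)) (9 / 16 * δ) with h | h <;> rw [h]
  · exact h1
  · exact h5

end StepSize

end SSGD

theorem mainTheorem2 (c : ℝ) (hc : 1 ≤ c) :
    ∃ C : ℝ, 0 < C ∧
      ∀ (d : ℕ) (Z Ω : Type*) [MeasurableSpace Z] [MeasurableSpace Ω]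
        (P : Measure Ω) [IsProbabilityMeasure P] (ν : Measure Z)
        (ζ : ℕ → Ω → Z) (Γ : SSGD.Vec d → Z → SSGD.Vec d) (F D : SSGD.Vec d → ℝ)
        (vstar v₀ : SSGD.Vec d) (LD LF LK LQ : ℝ≥0) (δ μ α V ρ η ε : ℝ) (T : ℕ),
        -- the samples are i.i.d. with law `ν`
        (∀ t, Measurable (ζ t)) → iIndepFun ζ P → (∀ t, P.map (ζ t) = ν) →
        SSGD.UnbiasedScaledGradient ν Γ F D →
        -- `vstar` is a local minimizer on the sphere with positive manifold Hessian
        vstar ∈ SSGD.unitSphere d → IsLocalMinOn F (SSGD.unitSphere d) vstar →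
        0 < μ →
        (∀ u : SSGD.Vec d, inner ℝ u vstar = 0 → ‖u‖ = 1 →
          μ ≤ inner ℝ u (SSGD.manifoldHessian F vstar u)) →
        -- smoothness and tail assumptions
        0 < δ → δ ≤ 1 → SSGD.LocallySmooth F D vstar δ LD LF LK LQ →
        0 < α → α ≤ 2 → 0 < V → SSGD.SubWeibull ν Γ α V →
        ρ = SSGD.rho (D vstar) LD LF LK LQ →
        -- warm start
        v₀ ∈ SSGD.unitSphere d →
        ‖v₀ - vstar‖ ≤ min (D vstar * μ / (2 ^ 5 * ρ)) (δ / 2) →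
        -- sample size, confidence parameter and step size
        2 ≤ T → 0 < ε → ε < 1 →
        Real.log T / (D vstar * μ * T) ≤ η → η ≤ c * (Real.log T / (D vstar * μ * T)) →
        η ≤ min
          (min (D vstar ^ 3 * μ ^ 3 / (2 ^ 24 * SSGD.G α * V ^ 2 * ρ ^ 2))
              (D vstar * μ * δ ^ 2 / (2 ^ 16 * SSGD.G α * V ^ 2)) *
            Real.log (1 / ε) ^ (-((α + 2) / α)))
          (1 / (D vstar * μ)) →
        ∃ H : Set Ω, MeasurableSet H ∧
          1 - (14 + 8 * (3 / α) ^ (2 / α) * Real.log (1 / ε) ^ (-((α + 2) / α))) * T * ε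
            ≤ P.real H ∧
          ∀ ω ∈ H,
            ‖SSGD.iterate Γ η v₀ (fun t => ζ t ω) T - vstar‖ ≤
              C * (SSGD.G α * V / (D vstar * μ)) * Real.log (1 / ε) ^ ((α + 2) / (2 * α)) *
                √(Real.log T / T) := by
  refine ⟨5 * c, by linarith, ?_⟩
  intro d Z Ω _ _ P _ ν ζ Γ F D vstar v₀ LD LF LK LQ δ μ α V ρ η ε T hζ hind hlaw hΓ hvs hmin
    hμ0 hμ hδ0 hδ hS hα hα2 hV hW hρ hv₀ hwarm hT hε0 hε1 hηlow hηup hηmin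
  by_cases hbig : 1 ≤ (14 + 8 * (3 / α) ^ (2 / α) * Real.log (1 / ε) ^ (-((α + 2) / α))) * T * ε
  · refine ⟨∅, MeasurableSet.empty, ?_, fun ω hω => hω.elim⟩
    rw [measureReal_empty]
    linarith
  have hvs1 : ‖vstar‖ = 1 := mem_sphere_zero_iff_norm.1 hvs
  have hv₀1 : ‖v₀‖ = 1 := mem_sphere_zero_iff_norm.1 hv₀
  have hν : IsProbabilityMeasure ν :=
    hlaw 0 ▸ Measure.isProbabilityMeasure_map (hζ 0).aemeasurable
  have hG := SSGD.one_le_G hα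
  have hD : 0 < D vstar := hΓ.scale_pos _ hvs
  set m : ℝ := D vstar * μ with hm
  have hm0 : 0 < m := mul_pos hD hμ0
  have hρ0 : 0 < ρ := by
    obtain ⟨h1, h2, h3, h4⟩ := hS.pos
    rw [hρ, SSGD.rho]
    positivity
  have hT0 : (2 : ℝ) ≤ T := by exact_mod_cast hT
  set L : ℝ := Real.log (1 / ε) with hL
  have hL0 : 0 ≤ L := Real.log_nonneg ((one_le_div hε0).2 hε1.le)
  have hεL : Real.exp (-L) = ε := by
    rw [hL, one_div, Real.log_inv, neg_neg, Real.exp_log hε0]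
  have hfail : 14 * T * ε ≤
      (14 + 8 * (3 / α) ^ (2 / α) * L ^ (-((α + 2) / α))) * T * ε := by
    have : 0 ≤ 8 * (3 / α) ^ (2 / α) * L ^ (-((α + 2) / α)) := by positivity
    gcongr
    linarith
  have hTε : 14 * T * ε < 1 := hfail.trans_lt (not_le.1 hbig)
  have hL1 : 1 ≤ L := by
    rw [hL, Real.le_log_iff_exp_le (by positivity), le_div_iff₀ hε0]
    have := Real.exp_one_lt_d9
    nlinarith
  have hLpos : 0 < L := by linarith
  set W : ℝ := L ^ (2 / α) with hWdef
  have hW1 : 1 ≤ W := Real.one_le_rpow hL1 (by positivity)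
  have hB2 : (V * L ^ (1 / α)) ^ 2 = V ^ 2 * W := by rw [mul_pow, SSGD.sq_rpow_one_div hL0]
  have hLneg : L ^ (-((α + 2) / α)) = (L * W)⁻¹ := SSGD.rpow_neg_add_two_div hα hL0
  have hLW1 : 1 ≤ L * W := one_le_mul_of_one_le_of_one_le hL1 hW1
  have hlogT := SSGD.sixty_nine_div_hundred_le_log hT0
  have hη0 : 0 < η := lt_of_lt_of_le (by positivity) hηlow
  have hηm1 : η * m ≤ 1 := by
    have := hηmin.trans (min_le_right _ _)
    rwa [le_div_iff₀ hm0] at this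
  have hηm2 : Real.log T / T ≤ η * m := by
    rw [div_le_iff₀ (by positivity)] at hηlow ⊢
    linarith
  have hN1 : η * (V ^ 2 * SSGD.G α) * (L * W) / m ≤ (m / (2 ^ 12 * ρ)) ^ 2 := by
    refine SSGD.noise_le_sq_curvature_radius hV hm0 hρ0 (by linarith) (by linarith) ?_
    rw [← hLneg, hm, mul_pow]
    refine (hηmin.trans (min_le_left _ _)).trans ?_
    exact mul_le_mul_of_nonneg_right (min_le_left _ _) (Real.rpow_nonneg hL0 _)
  have hN2 : η * (V ^ 2 * SSGD.G α) * (L * W) / m ≤ (δ / 2 ^ 8) ^ 2 := by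
    refine SSGD.noise_le_sq_smooth_radius hV hm0 (by linarith) (by linarith) ?_
    rw [← hLneg]
    refine (hηmin.trans (min_le_left _ _)).trans ?_
    exact mul_le_mul_of_nonneg_right (min_le_right _ _) (Real.rpow_nonneg hL0 _)
  have hηB : η * (V * L ^ (1 / α)) ≤ 1 / 2 := by
    refine SSGD.truncated_step_le (by positivity) hB2 hV hm0 hη0 hηm1 hG hL1 hW1
      (hN2.trans ?_)
    exact pow_le_pow_left₀ (by positivity) (by linarith) 2
  -- Below `R` both the cubic error and the distance to the boundary of the region are controlled.
  obtain ⟨R, hR⟩ : ∃ R, R = min (m / (16 * ρ)) (9 / 16 * δ) := ⟨_, rfl⟩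
  have hR0 : 0 ≤ R := by rw [hR]; positivity
  have hRδ : R ≤ 9 / 16 * δ := hR ▸ min_le_right _ _
  have hRρ : R ≤ m / (16 * ρ) := hR ▸ min_le_left _ _
  have hdrift : ∀ u : SSGD.Vec d, ‖u‖ = 1 → ‖u - vstar‖ ≤ R →
      3 / 4 * m * ‖u - vstar‖ ^ 2 ≤ SSGD.tangentialInner u (u - vstar) (∫ z, Γ u z ∂ν) := by
    intro u hu hur
    rw [hΓ.mean_eq u (mem_sphere_zero_iff_norm.2 hu), map_smul, SSGD.tangentialInner_apply,
      smul_eq_mul]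
    refine hS.drift hvs1 hmin hδ0 hδ hμ0 hμ hu (by linarith) (by linarith) hD ?_
    rw [← hρ, ← hm]
    calc ρ * ‖u - vstar‖ ≤ ρ * (m / (16 * ρ)) :=
          mul_le_mul_of_nonneg_left (hur.trans hRρ) hρ0.le
      _ = m / 16 := by field_simp
  have hεη : 8 * ε ≤ η * m := by
    refine le_trans ?_ hηm2
    rw [le_div_iff₀ (by linarith)]
    linarith
  have hsum := SSGD.stationary_level_le hB2 hV hm0 hη0 hG hL1 hW1 hεη
  rw [← hεL] at hsum
  obtain ⟨K, hK⟩ : ∃ K, K = (8 * η ^ 2 * (V * L ^ (1 / α)) ^ 2 +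
      16 * η * Real.exp (-L) * (V ^ 2 * SSGD.G α) / m) / (η * m) := ⟨_, rfl⟩
  have hK0 : 0 ≤ K := by rw [hK]; positivity
  have hKeq : 8 * η ^ 2 * (V * L ^ (1 / α)) ^ 2 +
      16 * η * Real.exp (-L) * (V ^ 2 * SSGD.G α) / m = η * m * K := by
    rw [hK, mul_div_cancel₀ _ (by positivity)]
  rw [← hK] at hsum
  have hR2 : ‖v₀ - vstar‖ ^ 2 + K + L / (m / (8 * η * (V * L ^ (1 / α)) ^ 2)) ≤ R ^ 2 := by
    have := SSGD.sq_add_noise_le_sq_min (norm_nonneg _) (hwarm.trans (min_le_left _ _))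
      (hwarm.trans (min_le_right _ _)) hN1 hN2
    rw [hR]
    linarith
  obtain ⟨H, hHm, hHP, hH⟩ := SSGD.exists_event_norm_iterate_sub_sq_le hζ hind hlaw
    hΓ.measurable hα hV hW hvs1 hv₀1 hm0 hη0 hR0 (by linarith) hLpos hηm1 hηB hK0 hKeq hdrift
    hR2 T
  refine ⟨H, hHm, ?_, fun ω hω => ?_⟩
  · have h1 : P.real Hᶜ ≤ 3 * T * ε := by
      rw [hεL] at hHP
      exact ENNReal.toReal_le_of_le_ofReal (by positivity) hHP
    rw [probReal_compl_eq_one_sub hHm] at h1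
    have h2 : 0 ≤ (T : ℝ) * ε := by positivity
    linarith
  · have h1 := hH ω hω
    have hf : Measurable (Γ v₀) := hΓ.measurable.of_uncurry_left
    have hv₀R : ‖v₀ - vstar‖ ≤ R := by
      refine (sq_le_sq₀ (norm_nonneg _) hR0).1 (le_trans ?_ hR2)
      have : 0 ≤ L / (m / (8 * η * (V * L ^ (1 / α)) ^ 2)) := by positivity
      linarith
    have hA0 : ‖v₀ - vstar‖ ^ 2 ≤ 4 * (V ^ 2 * SSGD.G α) / m ^ 2 :=
      SSGD.norm_sq_le_of_drift hf (SSGD.integrable_norm_sq hf hα hV (hW v₀ hv₀)) hm0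
        ((SSGD.integral_norm_sq_le hf hα hV (hW v₀ hv₀)).trans_eq (by ring)) hv₀1
        (hdrift v₀ hv₀1 hv₀R)
    have hfinal := SSGD.final_level_le hc hG hLW1 hV hm0 hT0 hηup
      (pow_nonneg (by linarith) T) (SSGD.one_sub_pow_le_log_div hT0 hηm1 hηm2) hA0
    refine (sq_le_sq₀ (norm_nonneg _) (by positivity)).1 ?_
    rw [mul_pow, mul_pow, SSGD.sq_rpow_add_two_div hα hL0, Real.sq_sqrt (by positivity)]
    linarith
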